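/- Let $M$ be a smooth $n$-dimensional manifold without boundary (Hausdorff, second countable), let $g$ be a continuous ($C^0$) Riemannian metric on $M$ with induced distance $\mathsf d_g$ (infimum of the $g$-lengths of curves; $\mathsf d_g=\infty$ between different components), let $h\in C^0(M,(0,\infty))$, and let $\mu$ be given by $\mathrm d\mu = h^2\,\mathrm d\mathrm{vol}_g$, where $\mathrm{vol}_g=\sqrt{|g|}\,\mathrm d\mathcal L^n$ in charts. Let $f:M\to\mathbb R$ be $C^1$, and let $\nabla f$ be its $g$-gradient. A test plan is a Borel probability measure $\boldsymbol\pi$ on $C([0,1],M)$ that is concentrated on absolutely continuous curves, with $(e_t)_\#\boldsymbol\pi\le C\mu$ for some constant $C$ and all $t\in[0,1]$, and with $\iint_0^1|\dot\gamma_t|^2\,\mathrm dt\,\mathrm d\boldsymbol\pi(\gamma)<\infty$, where $|\dot\gamma_t|$ is the metric speed with respect to $\mathsf d_g$. A $\mu$-measurable $G:M\to[0,\infty]$ is a *weak upper gradient* of $f$ if, for every test plan $\boldsymbol\pi$, $|f(\gamma_1)-f(\gamma_0)|\le\int_0^1G(\gamma_t)|\dot\gamma_t|\,\mathrm dt<\infty$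 for $\boldsymbol\pi$-a.e. $\gamma$; it is an *integrated weak upper gradient* of $f$ if, for every test plan $\boldsymbol\pi$, $$\int|f(\gamma_1)-f(\gamma_0)|\,\mathrm d\boldsymbol\pi(\gamma)\le\iint_0^1G(\gamma_t)|\dot\gamma_t|\,\mathrm dt\,\mathrm d\boldsymbol\pi(\gamma)<\infty .$$ In either class, $G$ is minimal if it belongs to the class and $G\le G'$ $\mu$-a.e. for every $G'$ in the class; it is then denoted $|Df|_w$ (it is unique up to $\mu$-null sets). Then: 1. $|\nabla f|_g$ is the minimal weak upper gradient of $f$, that is, $|Df|_w=|\nabla f|_g$ $\mu$-a.e. 2. If $f$ has an integrated weak upper gradient at all, then $|\nabla f|_g$ is the minimal one; and every minimal integrated weak upper gradient of $f$ equals $|\nabla f|_g$ $\mu$-a.e. If $|\nabla f|_g\in L^2(\mu)$, then $f$ has an integrated weak upper gradient. -/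

import Mathlib

open MeasureTheory Filter Topology Set Bundle Manifold
open scoped ENNReal NNReal ContDiff unitInterval

noncomputable section

/-! ## Curves, test plans and weak upper gradients in a metric measure space -/

section MetricMeasure

/-- The space `C([0,1], X)`, with its compact-open topology (uniform convergence), carries its
Borel σ-algebra. -/
instance instMeasurableSpaceCurve {X : Type*} [TopologicalSpace X] : MeasurableSpace C(I, X) :=
  borel _

instance instBorelSpaceCurve {X : Type*} [TopologicalSpace X] : BorelSpace C(I, X) := ⟨rfl⟩

variable {X : Type*} [PseudoEMetricSpace X]

/-- The metric speed `|γ̇_t| = lim_{s → t} d(γ_s, γ_t) / |s - t|`. It is written as a limsup, which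
is the limit wherever the limit exists; for an absolutely continuous curve this is the case for
almost every `t`. -/
def metricSpeed (γ : C(I, X)) (t : I) : ℝ≥0∞ :=
  limsup (fun s : I => edist (γ s) (γ t) / edist s t) (𝓝[≠] t)

/-- Absolutely continuous curves: there is an integrable `m` on `[0,1]` such that
`d(γ_s, γ_t) ≤ ∫_s^t m(r) dr` for all `s ≤ t`. -/
def IsAbsolutelyContinuousCurve (γ : C(I, X)) : Prop :=
  ∃ m : I → ℝ≥0∞, Measurable m ∧ ∫⁻ r, m r < ⊤ ∧
    ∀ s t : I, s ≤ t → edist (γ s) (γ t) ≤ ∫⁻ r in Icc s t, m r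

variable [MeasurableSpace X]

/-- Test plans on the metric measure space `(X, d, m)`: Borel probability measures on `C([0,1], X)`
with bounded compression and finite kinetic energy. The energy of a curve that is not absolutely
continuous counts as infinite, so that finiteness of the total energy means that almost every
curve is absolutely continuous and that the integral of `|γ̇_t|²` is finite. -/
structure IsTestPlan (m : Measure X) (P : Measure C(I, X)) : Prop where
  isProbabilityMeasure : IsProbabilityMeasure P
  bounded_compression : ∃ C : ℝ≥0, ∀ t : I, P.map (fun γ => γ t) ≤ C • m
  ae_absolutelyContinuous : ∀ᵐ γ ∂P, IsAbsolutelyContinuousCurve γ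
  finite_energy : ∫⁻ γ, (∫⁻ t, metricSpeed γ t ^ 2) ∂P < ⊤

/-- Weak upper gradients in integrated form:
`∫ |f(γ₁) - f(γ₀)| dP ≤ ∫∫ G(γ_t) |γ̇_t| dt dP < ∞` for every test plan `P`. -/
structure IsWeakUpperGradient (m : Measure X) (f : X → ℝ) (G : X → ℝ≥0∞) : Prop where
  aemeasurable : AEMeasurable G m
  le_lintegral : ∀ P : Measure C(I, X), IsTestPlan m P →
    ∫⁻ γ, ‖f (γ 1) - f (γ 0)‖ₑ ∂P ≤ ∫⁻ γ, (∫⁻ t, G (γ t) * metricSpeed γ t) ∂P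
  lintegral_lt_top : ∀ P : Measure C(I, X), IsTestPlan m P →
    ∫⁻ γ, (∫⁻ t, G (γ t) * metricSpeed γ t) ∂P < ⊤

/-- Weak upper gradients in curvewise form: for every test plan `P`,
`|f(γ₁) - f(γ₀)| ≤ ∫ G(γ_t) |γ̇_t| dt < ∞` for `P`-almost every curve `γ`. -/
structure IsCurvewiseWeakUpperGradient (m : Measure X) (f : X → ℝ) (G : X → ℝ≥0∞) : Prop where
  aemeasurable : AEMeasurable G m
  ae_le_lintegral : ∀ P : Measure C(I, X), IsTestPlan m P →
    ∀ᵐ γ ∂P, ‖f (γ 1) - f (γ 0)‖ₑ ≤ ∫⁻ t, G (γ t) * metricSpeed γ t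
  ae_lintegral_lt_top : ∀ P : Measure C(I, X), IsTestPlan m P →
    ∀ᵐ γ ∂P, ∫⁻ t, G (γ t) * metricSpeed γ t < ⊤

/-- `G` is the minimal weak upper gradient `|Df|_w` of `f` (unique up to null sets), in the
integrated form. -/
def IsMinimalWeakUpperGradient (m : Measure X) (f : X → ℝ) (G : X → ℝ≥0∞) : Prop :=
  IsWeakUpperGradient m f G ∧ ∀ G' : X → ℝ≥0∞, IsWeakUpperGradient m f G' → G ≤ᵐ[m] G'

/-- `G` is the minimal weak upper gradient `|Df|_w` of `f` (unique up to null sets), in the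
curvewise form. -/
def IsMinimalCurvewiseWeakUpperGradient (m : Measure X) (f : X → ℝ) (G : X → ℝ≥0∞) : Prop :=
  IsCurvewiseWeakUpperGradient m f G ∧
    ∀ G' : X → ℝ≥0∞, IsCurvewiseWeakUpperGradient m f G' → G ≤ᵐ[m] G'

end MetricMeasure

/-! ## Gradient and volume measure of a Riemannian metric -/

section Riemannian

variable {n : ℕ} {M : Type*} [TopologicalSpace M] [ChartedSpace (EuclideanSpace ℝ (Fin n)) M]
  [RiemannianBundle (fun x : M => TangentSpace (𝓡 n) x)]

/-- The gradient `∇f(x) ∈ T_x M`: the vector that represents the differential `df_x` through the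
inner product `g_x`. -/
def riemannianGradient (f : M → ℝ) (x : M) : TangentSpace (𝓡 n) x :=
  haveI : FiniteDimensional ℝ (TangentSpace (𝓡 n) x) :=
    inferInstanceAs (FiniteDimensional ℝ (EuclideanSpace ℝ (Fin n)))
  haveI : CompleteSpace (TangentSpace (𝓡 n) x) := FiniteDimensional.complete ℝ _
  (InnerProductSpace.toDual ℝ (TangentSpace (𝓡 n) x)).symm (mfderiv (𝓡 n) 𝓘(ℝ, ℝ) f x)

/-- The matrix `(g_ij)` in the chart `φ` at the point with coordinates `y`, i.e. the Gram matrix of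
the coordinate vector fields. -/
def chartGramMatrix (φ : OpenPartialHomeomorph M (EuclideanSpace ℝ (Fin n)))
    (y : EuclideanSpace ℝ (Fin n)) : Matrix (Fin n) (Fin n) ℝ :=
  Matrix.of fun i j =>
    inner ℝ
      (mfderiv (𝓡 n) (𝓡 n) φ.symm y (EuclideanSpace.single i (1 : ℝ) : EuclideanSpace ℝ (Fin n)))
      (mfderiv (𝓡 n) (𝓡 n) φ.symm y (EuclideanSpace.single j (1 : ℝ) : EuclideanSpace ℝ (Fin n)))

variable [MeasurableSpace M]

/-- The measure `√|g| dx¹ … dxⁿ` of the domain of the chart `φ`, as a measure on `M` that vanishes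
outside that domain. -/
def chartVolume (φ : OpenPartialHomeomorph M (EuclideanSpace ℝ (Fin n))) : Measure M :=
  ((volume.restrict φ.target).withDensity
    fun y => ENNReal.ofReal (Real.sqrt (chartGramMatrix φ y).det)).map φ.symm

variable (n M) in
/-- The Riemannian volume measure: the measure that is `√|g| dx¹ … dxⁿ` in every chart. The local
measures agree on overlaps, so that it is their least upper bound in the lattice of measures. -/
def riemannianVolume : Measure M :=
  ⨆ φ ∈ atlas (EuclideanSpace ℝ (Fin n)) M, chartVolume φ

/-- The weighted measure `dμ = h² dvol_g`. -/
def weightedRiemannianVolume (n : ℕ) {M : Type*} [TopologicalSpace M]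
    [ChartedSpace (EuclideanSpace ℝ (Fin n)) M]
    [RiemannianBundle (fun x : M => TangentSpace (𝓡 n) x)] [MeasurableSpace M]
    (h : M → ℝ) : Measure M :=
  (riemannianVolume n M).withDensity fun x => ENNReal.ofReal (h x ^ 2)

end Riemannian

end

/-!
The upper bound. A `C¹` function is Lipschitz near each point `x` with any constant larger than
`|∇f|(x)`, because `|∇f|` is upper semicontinuous and nearly shortest curves between points close to
`x` stay close to `x` (`exists_lipschitzOnWith_of_norm_riemannianGradient_lt`). Hence along an
absolutely continuous curve `γ` of finite energy the function `f ∘ γ` is absolutely continuous with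
`|(f ∘ γ)'| ≤ |∇f|(γ) |γ̇|` almost everywhere, and the fundamental theorem of calculus shows that
`|∇f|` is a curvewise weak upper gradient (`isCurvewiseWeakUpperGradient_of_lipschitzOnWith`).

The two notions. Conditioning a test plan on a set of curves of positive measure gives a test plan,
so that every integrated weak upper gradient is a curvewise one
(`IsWeakUpperGradient.isCurvewiseWeakUpperGradient`). It is therefore enough to bound curvewise weak
upper gradients from below. The integrated inequality for `|∇f|` follows by integration, and the
finiteness that it needs comes either from `|∇f| ≤ G` for some integrated weak upper gradient `G` or
from `|∇f| ∈ L²(μ)`.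

The lower bound. Let `G` be a curvewise weak upper gradient. In a chart `φ` fix a direction `v`. The
segments in the direction `v` that start from a uniformly distributed point of a small ball form a
test plan (`isTestPlan_segmentPlan`), so that for almost every base point the increments of `f` over
all rational subsegments are bounded by the integrals of `G |dφ⁻¹ v|`. Lebesgue differentiation
along the line and Fubini's theorem give `|df(dφ⁻¹ v)| ≤ G |dφ⁻¹ v|` almost everywhere
(`ae_enorm_fderiv_le`). Letting `v` range over a countable dense set of directions yields
`|∇f| ≤ G` almost everywhere (`IsCurvewiseWeakUpperGradient.enorm_riemannianGradient_le`).

No change of variables between charts is needed: a measurable set that is null in all charts is null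
for the supremum of the chart volumes (`riemannianVolume_eq_zero`), and this supremum dominates the
volume of each single chart (`eventually_map_volume_le_weightedRiemannianVolume`).
-/

noncomputable section

/-! ### The coordinate frame of a chart -/

section Chart

variable {n : ℕ} {M : Type*} [TopologicalSpace M] [ChartedSpace (EuclideanSpace ℝ (Fin n)) M]

/-- The tangent vector `dφ⁻¹_y(v)` with coordinates `v` in the chart `φ`, at the point with
coordinates `y`. -/
def coordVec (φ : OpenPartialHomeomorph M (EuclideanSpace ℝ (Fin n)))
    (y v : EuclideanSpace ℝ (Fin n)) : TangentSpace (𝓡 n) (φ.symm y) :=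
  mfderiv (𝓡 n) (𝓡 n) φ.symm y v

variable {φ : OpenPartialHomeomorph M (EuclideanSpace ℝ (Fin n))}

lemma coordVec_add (y v w : EuclideanSpace ℝ (Fin n)) :
    coordVec φ y (v + w) = coordVec φ y v + coordVec φ y w :=
  map_add (mfderiv (𝓡 n) (𝓡 n) φ.symm y) v w

lemma coordVec_smul (y : EuclideanSpace ℝ (Fin n)) (c : ℝ) (v : EuclideanSpace ℝ (Fin n)) :
    coordVec φ y (c • v) = c • coordVec φ y v :=
  map_smul (mfderiv (𝓡 n) (𝓡 n) φ.symm y) c v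

variable [IsManifold (𝓡 n) ∞ M]

lemma contMDiffOn_symm_of_mem_atlas (hφ : φ ∈ atlas (EuclideanSpace ℝ (Fin n)) M) :
    ContMDiffOn (𝓡 n) (𝓡 n) 1 φ.symm φ.target := by
  have : IsManifold (𝓡 n) 1 M := IsManifold.of_le (n := ∞) (by simp)
  exact contMDiffOn_symm_of_mem_maximalAtlas (IsManifold.subset_maximalAtlas hφ)

lemma mdifferentiable_of_mem_chart_atlas (hφ : φ ∈ atlas (EuclideanSpace ℝ (Fin n)) M) :
    φ.MDifferentiable (𝓡 n) (𝓡 n) :=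
  mdifferentiable_of_mem_atlas hφ

lemma bijective_coordVec (hφ : φ ∈ atlas (EuclideanSpace ℝ (Fin n)) M)
    {y : EuclideanSpace ℝ (Fin n)} (hy : y ∈ φ.target) :
    Function.Bijective (coordVec φ y) :=
  (mdifferentiable_of_mem_chart_atlas hφ).symm.mfderiv_bijective hy

/-- The vector `dφ⁻¹_y(v)` depends continuously on `(y, v)`, as a point of the tangent bundle. -/
lemma continuousOn_coordVec (hφ : φ ∈ atlas (EuclideanSpace ℝ (Fin n)) M) :
    ContinuousOn (fun p : EuclideanSpace ℝ (Fin n) × EuclideanSpace ℝ (Fin n) =>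
      (TotalSpace.mk (φ.symm p.1) (coordVec φ p.1 p.2) : TangentBundle (𝓡 n) M))
      (φ.target ×ˢ univ) := by
  have h1 := (contMDiffOn_symm_of_mem_atlas hφ).continuousOn_tangentMapWithin le_rfl
    φ.open_target.uniqueMDiffOn
  have h2 : Continuous (fun p : EuclideanSpace ℝ (Fin n) × EuclideanSpace ℝ (Fin n) =>
      (TotalSpace.mk p.1 p.2 : TangentBundle (𝓡 n) (EuclideanSpace ℝ (Fin n)))) :=
    (tangentBundleModelSpaceHomeomorph (𝓡 n)).symm.continuous
  refine (h1.comp h2.continuousOn (fun p hp => hp.1)).congr fun p hp => ?_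
  simp only [Function.comp, tangentMapWithin, coordVec]
  rw [mfderivWithin_of_isOpen φ.open_target hp.1]

variable [RiemannianBundle (fun x : M => TangentSpace (𝓡 n) x)]

/-- The coordinate vector fields are linearly independent, so that `√|g|` does not vanish. -/
lemma det_chartGramMatrix_pos (hφ : φ ∈ atlas (EuclideanSpace ℝ (Fin n)) M)
    {y : EuclideanSpace ℝ (Fin n)} (hy : y ∈ φ.target) : 0 < (chartGramMatrix φ y).det := by
  let L : EuclideanSpace ℝ (Fin n) →ₗ[ℝ] TangentSpace (𝓡 n) (φ.symm y) :=
    { toFun := coordVec φ y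
      map_add' := coordVec_add y
      map_smul' := coordVec_smul y }
  have hli : LinearIndependent ℝ (fun i : Fin n => coordVec φ y (EuclideanSpace.single i 1)) := by
    have h := (EuclideanSpace.basisFun (Fin n) ℝ).toBasis.linearIndependent.map_injOn L
      (bijective_coordVec hφ hy).1.injOn
    have e : (fun i : Fin n => coordVec φ y (EuclideanSpace.single i 1)) =
        L ∘ (EuclideanSpace.basisFun (Fin n) ℝ).toBasis := by
      ext1 i
      simp [L]
    rw [e]
    exact h
  exact (Matrix.posDef_gram_of_linearIndependent hli).det_pos

variable [IsContinuousRiemannianBundle (EuclideanSpace ℝ (Fin n))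
  (fun x : M => TangentSpace (𝓡 n) x)]

lemma continuousOn_inner_coordVec (hφ : φ ∈ atlas (EuclideanSpace ℝ (Fin n)) M) :
    ContinuousOn (fun p : EuclideanSpace ℝ (Fin n) ×
        (EuclideanSpace ℝ (Fin n) × EuclideanSpace ℝ (Fin n)) =>
      (inner ℝ (coordVec φ p.1 p.2.1) (coordVec φ p.1 p.2.2) : ℝ)) (φ.target ×ˢ univ) := by
  have h1 := (continuousOn_coordVec hφ).comp
    (f := fun p : EuclideanSpace ℝ (Fin n) ×
        (EuclideanSpace ℝ (Fin n) × EuclideanSpace ℝ (Fin n)) => (p.1, p.2.1))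
    (s := φ.target ×ˢ univ) (by fun_prop) (fun p hp => ⟨hp.1, trivial⟩)
  have h2 := (continuousOn_coordVec hφ).comp
    (f := fun p : EuclideanSpace ℝ (Fin n) ×
        (EuclideanSpace ℝ (Fin n) × EuclideanSpace ℝ (Fin n)) => (p.1, p.2.2))
    (s := φ.target ×ˢ univ) (by fun_prop) (fun p hp => ⟨hp.1, trivial⟩)
  intro p hp
  exact ContinuousWithinAt.inner_bundle (F := EuclideanSpace ℝ (Fin n))
    (E := fun x : M => TangentSpace (𝓡 n) x) (M := EuclideanSpace ℝ (Fin n) × (EuclideanSpace ℝ (Fin n) × EuclideanSpace ℝ (Fin n)))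
    (b := fun p => φ.symm p.1) (v := fun p => coordVec φ p.1 p.2.1)
    (w := fun p => coordVec φ p.1 p.2.2) (h1 p hp) (h2 p hp)

lemma continuousOn_norm_coordVec (hφ : φ ∈ atlas (EuclideanSpace ℝ (Fin n)) M) :
    ContinuousOn (fun p : EuclideanSpace ℝ (Fin n) × EuclideanSpace ℝ (Fin n) =>
      ‖coordVec φ p.1 p.2‖) (φ.target ×ˢ univ) := by
  have h := (continuousOn_inner_coordVec hφ).comp
    (f := fun p : EuclideanSpace ℝ (Fin n) × EuclideanSpace ℝ (Fin n) => (p.1, (p.2, p.2)))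
    (s := φ.target ×ˢ univ) (by fun_prop) (fun p hp => ⟨hp.1, trivial⟩)
  refine h.sqrt.congr fun p _ => ?_
  exact norm_eq_sqrt_real_inner _

lemma continuousOn_enorm_coordVec (hφ : φ ∈ atlas (EuclideanSpace ℝ (Fin n)) M)
    (v : EuclideanSpace ℝ (Fin n)) :
    ContinuousOn (fun y => ‖coordVec φ y v‖ₑ) φ.target := by
  have h := (continuousOn_norm_coordVec hφ).comp
    (f := fun y : EuclideanSpace ℝ (Fin n) => (y, v))
    (s := φ.target) (by fun_prop) (fun p hp => ⟨hp, trivial⟩)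
  refine (ENNReal.continuous_ofReal.comp_continuousOn h).congr fun y _ => ?_
  exact (ofReal_norm _).symm

lemma continuousOn_det_chartGramMatrix (hφ : φ ∈ atlas (EuclideanSpace ℝ (Fin n)) M) :
    ContinuousOn (fun y => (chartGramMatrix φ y).det) φ.target := by
  refine ContinuousOn.comp (g := Matrix.det) (t := univ) (by fun_prop) ?_ (fun _ _ => trivial)
  refine continuousOn_pi.2 fun i => continuousOn_pi.2 fun j => ?_
  exact (continuousOn_inner_coordVec hφ).comp
    (f := fun y : EuclideanSpace ℝ (Fin n) =>
      (y, ((EuclideanSpace.single i (1 : ℝ) : EuclideanSpace ℝ (Fin n)),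
        (EuclideanSpace.single j (1 : ℝ) : EuclideanSpace ℝ (Fin n)))))
    (by fun_prop) (fun p hp => ⟨hp, trivial⟩)

end Chart

/-! ### The gradient of a `C¹` function -/

lemma inner_riemannianGradient {n : ℕ} {M : Type*} [TopologicalSpace M]
    [ChartedSpace (EuclideanSpace ℝ (Fin n)) M]
    [RiemannianBundle (fun x : M => TangentSpace (𝓡 n) x)] (f : M → ℝ) (x : M)
    (u : TangentSpace (𝓡 n) x) :
    inner ℝ (riemannianGradient (n := n) f x) u = (mfderiv (𝓡 n) 𝓘(ℝ, ℝ) f x u : ℝ) := by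
  have : FiniteDimensional ℝ (TangentSpace (𝓡 n) x) :=
    inferInstanceAs (FiniteDimensional ℝ (EuclideanSpace ℝ (Fin n)))
  have : CompleteSpace (TangentSpace (𝓡 n) x) := FiniteDimensional.complete ℝ _
  exact InnerProductSpace.toDual_symm_apply

section Gradient

variable {n : ℕ} {M : Type*} [TopologicalSpace M] [ChartedSpace (EuclideanSpace ℝ (Fin n)) M]
  [IsManifold (𝓡 n) ∞ M] {φ : OpenPartialHomeomorph M (EuclideanSpace ℝ (Fin n))} {f : M → ℝ}

lemma contDiffOn_comp_chart_symm (hf : ContMDiff (𝓡 n) 𝓘(ℝ, ℝ) 1 f)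
    (hφ : φ ∈ atlas (EuclideanSpace ℝ (Fin n)) M) :
    ContDiffOn ℝ 1 (f ∘ φ.symm) φ.target :=
  contMDiffOn_iff_contDiffOn.1 (hf.comp_contMDiffOn (contMDiffOn_symm_of_mem_atlas hφ))

lemma differentiableAt_comp_chart_symm (hf : ContMDiff (𝓡 n) 𝓘(ℝ, ℝ) 1 f)
    (hφ : φ ∈ atlas (EuclideanSpace ℝ (Fin n)) M) {y : EuclideanSpace ℝ (Fin n)}
    (hy : y ∈ φ.target) : DifferentiableAt ℝ (f ∘ φ.symm) y :=
  ((contDiffOn_comp_chart_symm hf hφ).differentiableOn one_ne_zero y hy).differentiableAt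
    (φ.open_target.mem_nhds hy)

lemma continuousOn_fderiv_comp_chart_symm (hf : ContMDiff (𝓡 n) 𝓘(ℝ, ℝ) 1 f)
    (hφ : φ ∈ atlas (EuclideanSpace ℝ (Fin n)) M) :
    ContinuousOn (fderiv ℝ (f ∘ φ.symm)) φ.target :=
  (contDiffOn_comp_chart_symm hf hφ).continuousOn_fderiv_of_isOpen φ.open_target le_rfl

lemma continuousOn_enorm_fderiv_comp_chart_symm (hf : ContMDiff (𝓡 n) 𝓘(ℝ, ℝ) 1 f)
    (hφ : φ ∈ atlas (EuclideanSpace ℝ (Fin n)) M) (v : EuclideanSpace ℝ (Fin n)) :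
    ContinuousOn (fun z => ‖fderiv ℝ (f ∘ φ.symm) z v‖ₑ) φ.target :=
  ((continuousOn_fderiv_comp_chart_symm hf hφ).clm_apply continuousOn_const).enorm

variable [RiemannianBundle (fun x : M => TangentSpace (𝓡 n) x)]

/-- In a chart, the derivative of `f` in a coordinate direction is the inner product with `∇f`. -/
lemma fderiv_comp_chart_symm_apply (hf : ContMDiff (𝓡 n) 𝓘(ℝ, ℝ) 1 f)
    (hφ : φ ∈ atlas (EuclideanSpace ℝ (Fin n)) M) {y : EuclideanSpace ℝ (Fin n)}
    (hy : y ∈ φ.target) (v : EuclideanSpace ℝ (Fin n)) :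
    fderiv ℝ (f ∘ φ.symm) y v =
      inner ℝ (riemannianGradient (n := n) f (φ.symm y)) (coordVec φ y v) := by
  have h1 : MDifferentiableAt (𝓡 n) 𝓘(ℝ, ℝ) f (φ.symm y) :=
    (hf (φ.symm y)).mdifferentiableAt one_ne_zero
  have h2 : MDifferentiableAt (𝓡 n) (𝓡 n) φ.symm y :=
    (mdifferentiable_of_mem_chart_atlas hφ).symm.mdifferentiableAt hy
  have h := mfderiv_comp y h1 h2
  rw [inner_riemannianGradient, ← mfderiv_eq_fderiv]
  exact congrArg (fun L : EuclideanSpace ℝ (Fin n) →L[ℝ] ℝ => L v) h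

/-- A bound of the derivative in all coordinate directions bounds the gradient, since `∇f` is itself
the image of a coordinate vector. -/
lemma norm_riemannianGradient_le (hf : ContMDiff (𝓡 n) 𝓘(ℝ, ℝ) 1 f)
    (hφ : φ ∈ atlas (EuclideanSpace ℝ (Fin n)) M) {y : EuclideanSpace ℝ (Fin n)}
    (hy : y ∈ φ.target) {c : ℝ} (hc : 0 ≤ c)
    (h : ∀ v, |fderiv ℝ (f ∘ φ.symm) y v| ≤ c * ‖coordVec φ y v‖) :
    ‖riemannianGradient (n := n) f (φ.symm y)‖ ≤ c := by
  obtain ⟨v, hv⟩ := (bijective_coordVec hφ hy).2 (riemannianGradient (n := n) f (φ.symm y))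
  have h1 := h v
  rw [fderiv_comp_chart_symm_apply hf hφ hy, hv,
    real_inner_self_eq_norm_mul_norm, abs_mul_self] at h1
  rcases (norm_nonneg (riemannianGradient (n := n) f (φ.symm y))).eq_or_lt with h0 | h0
  · rwa [← h0]
  · exact le_of_mul_le_mul_right h1 h0

variable [IsContinuousRiemannianBundle (EuclideanSpace ℝ (Fin n))
  (fun x : M => TangentSpace (𝓡 n) x)]

/-- The function `|∇f|` is upper semicontinuous. In a chart the strict inequality
`|df(v)| < c |v|_g` is an open condition on the point and on `v`, so that it persists nearby
uniformly for `v` in the compact unit sphere. -/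
lemma upperSemicontinuous_norm_riemannianGradient (hf : ContMDiff (𝓡 n) 𝓘(ℝ, ℝ) 1 f) :
    UpperSemicontinuous (fun x : M => ‖riemannianGradient (n := n) f x‖) := by
  intro x c hc
  set φ := chartAt (EuclideanSpace ℝ (Fin n)) x with hφdef
  have hφ : φ ∈ atlas (EuclideanSpace ℝ (Fin n)) M := chart_mem_atlas _ x
  have hx : x ∈ φ.source := mem_chart_source _ x
  have hy : φ x ∈ φ.target := φ.map_source hx
  obtain ⟨c', hc1, hc2⟩ := exists_between hc
  have hc0 : 0 ≤ c' := (norm_nonneg _).trans hc1.le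
  have key : ∀ᶠ y in 𝓝 (φ x), ∀ v ∈ Metric.sphere (0 : EuclideanSpace ℝ (Fin n)) 1,
      |fderiv ℝ (f ∘ φ.symm) y v| < c' * ‖coordVec φ y v‖ := by
    refine (isCompact_sphere _ _).eventually_forall_of_forall_eventually fun v hv => ?_
    have hnhds : φ.target ×ˢ (univ : Set (EuclideanSpace ℝ (Fin n))) ∈ 𝓝 (φ x, v) :=
      (φ.open_target.prod isOpen_univ).mem_nhds ⟨hy, trivial⟩
    have hA : ContinuousAt (fun p : EuclideanSpace ℝ (Fin n) × EuclideanSpace ℝ (Fin n) =>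
        |fderiv ℝ (f ∘ φ.symm) p.1 p.2|) (φ x, v) := by
      have h1 : ContinuousAt (fun p : EuclideanSpace ℝ (Fin n) × EuclideanSpace ℝ (Fin n) =>
          fderiv ℝ (f ∘ φ.symm) p.1) (φ x, v) :=
        ContinuousAt.comp (g := fderiv ℝ (f ∘ φ.symm))
          ((continuousOn_fderiv_comp_chart_symm hf hφ).continuousAt (φ.open_target.mem_nhds hy))
          continuousAt_fst
      exact (h1.clm_apply continuousAt_snd).abs
    have hB := ((continuousOn_norm_coordVec hφ).continuousAt hnhds).const_mul c'
    refine hA.eventually_lt hB ?_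
    have hv0 : coordVec φ (φ x) v ≠ 0 := by
      intro h0
      have : v = 0 := (bijective_coordVec hφ hy).1
        (h0.trans (map_zero (mfderiv (𝓡 n) (𝓡 n) φ.symm (φ x))).symm)
      simp [this] at hv
    have h2 := abs_real_inner_le_norm (riemannianGradient (n := n) f (φ.symm (φ x)))
      (coordVec φ (φ x) v)
    rw [← fderiv_comp_chart_symm_apply hf hφ hy] at h2
    refine h2.trans_lt (mul_lt_mul_of_pos_right ?_ (norm_pos_iff.2 hv0))
    rwa [φ.left_inv hx]
  have h3 : ∀ᶠ z in 𝓝 x, ∀ v ∈ Metric.sphere (0 : EuclideanSpace ℝ (Fin n)) 1,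
      |fderiv ℝ (f ∘ φ.symm) (φ z) v| < c' * ‖coordVec φ (φ z) v‖ :=
    (φ.continuousAt hx).eventually key
  filter_upwards [h3, φ.open_source.mem_nhds hx] with z hz hzs
  refine lt_of_le_of_lt ?_ hc2
  rw [← φ.left_inv hzs]
  refine norm_riemannianGradient_le hf hφ (φ.map_source hzs) hc0 fun v => ?_
  rcases eq_or_ne v 0 with rfl | hv
  · simpa using mul_nonneg hc0 (norm_nonneg _)
  · have hvn : 0 < ‖v‖ := norm_pos_iff.2 hv
    have h4 := (hz (‖v‖⁻¹ • v) (by simp [norm_smul, hvn.ne'])).le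
    rw [coordVec_smul, norm_smul, map_smul, smul_eq_mul, abs_mul, norm_inv, norm_norm, abs_inv,
      abs_norm, mul_left_comm] at h4
    exact le_of_mul_le_mul_left h4 (inv_pos.2 hvn)

lemma measurable_enorm_riemannianGradient [MeasurableSpace M] [OpensMeasurableSpace M]
    (hf : ContMDiff (𝓡 n) 𝓘(ℝ, ℝ) 1 f) :
    Measurable (fun x : M => ‖riemannianGradient (n := n) f x‖ₑ) := by
  have h := (upperSemicontinuous_norm_riemannianGradient hf).measurable.ennreal_ofReal
  simpa only [ofReal_norm] using h

end Gradient

section Lipschitz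

variable {n : ℕ} {M : Type*} [EMetricSpace M] [ChartedSpace (EuclideanSpace ℝ (Fin n)) M]
  [IsManifold (𝓡 n) ∞ M] {f : M → ℝ}
  [RiemannianBundle (fun x : M => TangentSpace (𝓡 n) x)]
  [IsContinuousRiemannianBundle (EuclideanSpace ℝ (Fin n)) (fun x : M => TangentSpace (𝓡 n) x)]
  [IsRiemannianManifold (𝓡 n) M]

/-- Around `x`, a `C¹` function is Lipschitz with any constant larger than `|∇f|(x)`: nearly
shortest curves between points close to `x` stay in the region where `|∇f|` is below that
constant. -/
lemma exists_lipschitzOnWith_of_norm_riemannianGradient_lt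
    (hf : ContMDiff (𝓡 n) 𝓘(ℝ, ℝ) 1 f) {x : M} {c : ℝ≥0}
    (hc : ‖riemannianGradient (n := n) f x‖ < c) : ∃ U ∈ 𝓝 x, LipschitzOnWith c f U := by
  obtain ⟨r, hr, hball⟩ := EMetric.mem_nhds_iff.1
    (upperSemicontinuous_norm_riemannianGradient hf x c hc)
  have hr2 : 0 < r / 2 / 2 := by simp [hr.ne']
  refine ⟨Metric.eball x (r / 2 / 2), Metric.eball_mem_nhds x hr2, fun y hy z hz => ?_⟩
  have hdist : ∀ a b : M, edist a b = riemannianEDist (𝓡 n) a b :=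
    (inferInstance : IsRiemannianManifold (𝓡 n) M).out
  have hyz : edist y z < r / 2 := by
    calc edist y z ≤ edist y x + edist x z := edist_triangle _ _ _
      _ < r / 2 / 2 + r / 2 / 2 := by
        rw [edist_comm x z]
        exact ENNReal.add_lt_add hy hz
      _ = r / 2 := ENNReal.add_halves _
  -- A curve from `y` to `z` of length `l < r / 2` does not leave the ball of radius `r`.
  have main : ∀ l : ℝ≥0∞, edist y z < l → l < r / 2 → edist (f y) (f z) ≤ c * l := by
    intro l hl hlr
    rw [hdist] at hl
    obtain ⟨p, hp0, hp1, hp, hplen⟩ := exists_lt_of_riemannianEDist_lt hl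
    have hstay : ∀ t ∈ Icc (0 : ℝ) 1, ‖riemannianGradient (n := n) f (p t)‖ < c := by
      intro t ht
      apply hball
      have h1 : edist y (p t) < r / 2 := by
        rw [hdist]
        calc riemannianEDist (𝓡 n) y (p t) ≤ pathELength (𝓡 n) p 0 t :=
              riemannianEDist_le_pathELength (hp.mono (Icc_subset_Icc_right ht.2)) hp0 rfl ht.1
          _ ≤ pathELength (𝓡 n) p 0 1 := pathELength_mono le_rfl ht.2
          _ < r / 2 := hplen.trans hlr
      have h2 : r / 2 / 2 ≤ r / 2 := ENNReal.div_le_of_le_mul (by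
        rw [mul_two]; exact le_self_add)
      calc edist (p t) x ≤ edist (p t) y + edist y x := edist_triangle _ _ _
        _ < r / 2 + r / 2 := ENNReal.add_lt_add (by rwa [edist_comm]) (lt_of_lt_of_le hy h2)
        _ = r := ENNReal.add_halves _
    have hd := hf.comp_contMDiffOn hp
    rw [(inferInstance : IsRiemannianManifold 𝓘(ℝ, ℝ) ℝ).out (f y) (f z)]
    calc riemannianEDist 𝓘(ℝ, ℝ) (f y) (f z) ≤ pathELength 𝓘(ℝ, ℝ) (f ∘ p) 0 1 :=
          riemannianEDist_le_pathELength hd (by simp [hp0]) (by simp [hp1]) zero_le_one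
      _ ≤ c * pathELength (𝓡 n) p 0 1 := by
        rw [pathELength_eq_lintegral_mfderiv_Ioo, pathELength_eq_lintegral_mfderiv_Ioo,
          ← lintegral_const_mul' _ _ ENNReal.coe_ne_top]
        refine setLIntegral_mono' measurableSet_Ioo fun t ht => ?_
        have hpt : MDifferentiableAt 𝓘(ℝ, ℝ) (𝓡 n) p t :=
          ((hp t (Ioo_subset_Icc_self ht)).contMDiffAt (Icc_mem_nhds ht.1 ht.2)).mdifferentiableAt
            one_ne_zero
        have hft : MDifferentiableAt (𝓡 n) 𝓘(ℝ, ℝ) f (p t) :=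
          (hf (p t)).mdifferentiableAt one_ne_zero
        have h3 := mfderiv_comp t hft hpt
        have h4 := abs_real_inner_le_norm (riemannianGradient (n := n) f (p t))
          (mfderiv 𝓘(ℝ, ℝ) (𝓡 n) p t (1 : ℝ))
        rw [inner_riemannianGradient] at h4
        obtain ⟨d, hd⟩ : ∃ d : ℝ, d = mfderiv 𝓘(ℝ, ℝ) 𝓘(ℝ, ℝ) (f ∘ p) t (1 : ℝ) := ⟨_, rfl⟩
        have h5 : |d| ≤ c * ‖mfderiv 𝓘(ℝ, ℝ) (𝓡 n) p t (1 : ℝ)‖ := by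
          rw [hd, h3]
          exact h4.trans (mul_le_mul_of_nonneg_right
            (hstay t (Ioo_subset_Icc_self ht)).le (norm_nonneg _))
        have h6 : ‖mfderiv 𝓘(ℝ, ℝ) 𝓘(ℝ, ℝ) (f ∘ p) t (1 : ℝ)‖ₑ = ‖d‖ₑ := by
          rw [hd]
          exact enorm_tangentSpace_vectorSpace
        refine h6.trans_le ?_
        rw [← ofReal_norm, ← ofReal_norm, ← ENNReal.ofReal_coe_nnreal, ← ENNReal.ofReal_mul c.coe_nonneg]
        exact ENNReal.ofReal_le_ofReal h5
      _ ≤ c * l := by gcongr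
  have : (𝓝[>] (edist y z)).NeBot := nhdsGT_neBot_of_exists_gt ⟨_, hyz⟩
  have hlim : Tendsto (fun l : ℝ≥0∞ => c * l) (𝓝[>] (edist y z)) (𝓝 (c * edist y z)) :=
    ((ENNReal.continuous_const_mul ENNReal.coe_ne_top).tendsto _).mono_left nhdsWithin_le_nhds
  have hev : ∀ᶠ l in 𝓝[>] (edist y z), edist (f y) (f z) ≤ c * l := by
    filter_upwards [Ioo_mem_nhdsGT hyz] with l hl using main l hl.1 hl.2
  exact ge_of_tendsto hlim hev

lemma lipschitzOnWith_of_nnnorm_riemannianGradient_lt (hf : ContMDiff (𝓡 n) 𝓘(ℝ, ℝ) 1 f) (x : M)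
    (c : ℝ≥0) (hc : ‖riemannianGradient (n := n) f x‖₊ < c) : ∃ U ∈ 𝓝 x, LipschitzOnWith c f U :=
  exists_lipschitzOnWith_of_norm_riemannianGradient_lt hf (by exact_mod_cast hc)

end Lipschitz

/-! ### Metric speed and the chain rule along curves -/

section UnitInterval

lemma lintegral_Icc_unitInterval (g : ℝ → ℝ≥0∞) (s t : I) :
    ∫⁻ r in Icc s t, g r = ∫⁻ x in Icc (s : ℝ) t, g x := by
  have h := (unitInterval.measurePreserving_coe).setLIntegral_comp_preimage_emb
    (MeasurableEmbedding.subtype_coe measurableSet_Icc) g (Icc (s : ℝ) t)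
  rw [Measure.restrict_restrict_of_subset (Icc_subset_Icc s.2.1 t.2.2)] at h
  exact h

lemma lintegral_unitInterval (g : ℝ → ℝ≥0∞) :
    ∫⁻ r : I, g r = ∫⁻ x in Icc (0 : ℝ) 1, g x :=
  (unitInterval.measurePreserving_coe).lintegral_comp_emb
    (MeasurableEmbedding.subtype_coe measurableSet_Icc) g

lemma ae_unitInterval_of_ae {p : ℝ → Prop} (h : ∀ᵐ x : ℝ, p x) : ∀ᵐ t : I, p t :=
  (unitInterval.measurePreserving_coe).quasiMeasurePreserving.ae (ae_restrict_of_ae h)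

end UnitInterval

section Speed

variable {X : Type*} [PseudoEMetricSpace X]

lemma metricSpeed_eq_iInf (γ : C(I, X)) (t : I) :
    metricSpeed γ t = ⨅ k : ℕ, ⨆ s : I, ⨆ _ : s ∈ Metric.ball t (1 / ((k : ℝ) + 1)) ∩ {t}ᶜ,
      edist (γ s) (γ t) / edist s t := by
  rw [metricSpeed, (nhdsWithin_hasBasis Metric.nhds_basis_ball_inv_nat_succ _).limsup_eq_iInf_iSup]
  simp

/-- The metric speed is measurable in the curve and the time together: it is a countable infimum
of suprema of functions that are continuous on an open set and vanish off it, and those suprema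
are lower semicontinuous. -/
lemma measurable_metricSpeed :
    Measurable (fun p : C(I, X) × I => metricSpeed p.1 p.2) := by
  simp only [metricSpeed_eq_iInf]
  refine Measurable.iInf fun k => LowerSemicontinuous.measurable ?_
  refine lowerSemicontinuous_iSup fun s => ?_
  intro p c hc
  by_cases hs : s ∈ Metric.ball p.2 (1 / ((k : ℝ) + 1)) ∩ {p.2}ᶜ
  · have hc' : c < edist (p.1 s) (p.1 p.2) / edist s p.2 := by
      simpa only [iSup_pos hs] using hc
    have hcont : ContinuousAt (fun q : C(I, X) × I => edist (q.1 s) (q.1 q.2) / edist s q.2) p := by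
      refine ENNReal.Tendsto.div ?_ (Or.inr ?_) ?_ (Or.inl ?_)
      · have h1 : Continuous (fun q : C(I, X) × I => q.1 s) :=
          (continuous_eval_const s).comp continuous_fst
        have h2 : Continuous (fun q : C(I, X) × I => q.1 q.2) := continuous_eval
        exact (h1.edist h2).continuousAt
      · exact fun h => hs.2 (edist_eq_zero.1 h)
      · exact (continuous_const.edist continuous_snd).continuousAt
      · exact edist_ne_top _ _
    have hopen : ∀ᶠ q : C(I, X) × I in 𝓝 p, s ∈ Metric.ball q.2 (1 / ((k : ℝ) + 1)) ∩ {q.2}ᶜ := by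
      have h1 : ∀ᶠ q : C(I, X) × I in 𝓝 p, dist s q.2 < 1 / ((k : ℝ) + 1) :=
        (continuous_const.dist continuous_snd).continuousAt.eventually_lt continuousAt_const hs.1
      have h2 : ∀ᶠ q : C(I, X) × I in 𝓝 p, q.2 ≠ s :=
        continuousAt_snd.eventually_ne (fun h => hs.2 h.symm)
      filter_upwards [h1, h2] with q hq1 hq2 using ⟨hq1, fun h => hq2 h.symm⟩
    filter_upwards [hcont.eventually_const_lt hc', hopen] with q hq1 hq2
    simpa only [iSup_pos hq2] using hq1
  · simp only [iSup_neg hs] at hc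
    exact absurd hc not_lt_bot

lemma measurable_metricSpeed_right (γ : C(I, X)) : Measurable (fun t => metricSpeed γ t) := by
  have h1 : Measurable (fun t : I => (γ, t)) := measurable_prodMk_left
  have h2 := (measurable_metricSpeed (X := X)).comp h1
  simpa only [Function.comp_def] using h2

lemma isAbsolutelyContinuousCurve_of_edist_le {γ : C(I, X)} {c : ℝ≥0∞} (hc : c ≠ ⊤)
    (h : ∀ s t, edist (γ s) (γ t) ≤ c * edist s t) : IsAbsolutelyContinuousCurve γ := by
  refine ⟨fun _ => c, measurable_const, by simpa using hc.lt_top, fun s t hst => ?_⟩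
  refine (h s t).trans_eq ?_
  have hst' : (s : ℝ) ≤ t := hst
  rw [lintegral_Icc_unitInterval (fun _ => c), setLIntegral_const, Real.volume_Icc,
    Subtype.edist_eq, edist_dist, dist_comm, Real.dist_eq, abs_of_nonneg (sub_nonneg.2 hst')]

lemma metricSpeed_le_of_edist_le {γ : C(I, X)} {c : ℝ≥0∞}
    (h : ∀ s t, edist (γ s) (γ t) ≤ c * edist s t) (t : I) : metricSpeed γ t ≤ c := by
  refine limsup_le_of_le (by isBoundedDefault) ?_
  filter_upwards [self_mem_nhdsWithin] with s hs
  have hed : edist s t ≠ 0 := fun h => hs (edist_eq_zero.1 h)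
  rw [ENNReal.div_le_iff hed (edist_ne_top _ _)]
  exact h s t

end Speed

section Pointwise

variable {X : Type*} [PseudoEMetricSpace X]

/-- The pointwise chain rule `|(f ∘ γ)'(t)| ≤ |Df|(γ_t) |γ̇_t|`. The finiteness of the speed
excludes the product `0 * ∞`. -/
lemma enorm_deriv_le_mul_metricSpeed {f : X → ℝ} {γ : C(I, X)} {t : I} {a : ℝ≥0}
    (hlip : ∀ c : ℝ≥0, a < c → ∃ U ∈ 𝓝 (γ t), LipschitzOnWith c f U)
    {u : ℝ → ℝ} (hu : ∀ s : I, u s = f (γ s)) {u' : ℝ} (hderiv : HasDerivAt u u' t)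
    (hfin : metricSpeed γ t < ⊤) : ‖u'‖ₑ ≤ a * metricSpeed γ t := by
  have hlim : Tendsto (fun s : I => ‖u s - u t‖ₑ / edist s t) (𝓝[≠] t) (𝓝 ‖u'‖ₑ) := by
    have h1 : Tendsto (fun s : I => (s : ℝ)) (𝓝[≠] t) (𝓝[≠] (t : ℝ)) :=
      tendsto_nhdsWithin_iff.2 ⟨(continuous_subtype_val.tendsto t).mono_left nhdsWithin_le_nhds,
        by filter_upwards [self_mem_nhdsWithin] with s hs h using hs (Subtype.ext h)⟩
    have h2 := ((hasDerivAt_iff_tendsto_slope.1 hderiv).comp h1).enorm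
    refine h2.congr' ?_
    filter_upwards [self_mem_nhdsWithin] with s hs
    have hst : (s : ℝ) - t ≠ 0 := sub_ne_zero.2 fun h => hs (Subtype.ext h)
    simp only [Function.comp, slope, vsub_eq_sub, smul_eq_mul, enorm_mul]
    rw [enorm_inv hst, mul_comm, ← div_eq_mul_inv, Subtype.edist_eq, edist_eq_enorm_sub]
  have hne : (𝓝[≠] t).NeBot := inferInstance
  have main : ∀ c : ℝ≥0, a < c → ‖u'‖ₑ ≤ c * metricSpeed γ t := by
    intro c hc
    obtain ⟨U, hU, hL⟩ := hlip c hc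
    rw [← hlim.limsup_eq, metricSpeed, ← ENNReal.limsup_const_mul_of_ne_top ENNReal.coe_ne_top]
    refine limsup_le_limsup ?_
    have : ∀ᶠ s in 𝓝[≠] t, γ s ∈ U := nhdsWithin_le_nhds (γ.continuous.continuousAt hU)
    filter_upwards [this] with s hs
    rw [hu, hu, ← mul_div_assoc, ← edist_eq_enorm_sub]
    exact ENNReal.div_le_div_right (hL hs (mem_of_mem_nhds hU)) _
  have hlimc : Tendsto (fun c : ℝ≥0 => (c : ℝ≥0∞) * metricSpeed γ t) (𝓝[>] a)
      (𝓝 (a * metricSpeed γ t)) :=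
    ENNReal.Tendsto.mul_const
      (((ENNReal.continuous_coe.tendsto a)).mono_left nhdsWithin_le_nhds) (Or.inr hfin.ne)
  refine ge_of_tendsto hlimc ?_
  filter_upwards [self_mem_nhdsWithin] with c hc using main c hc

/-- A locally Lipschitz function is Lipschitz along a curve, at small scales and with a uniform
constant. -/
lemma exists_edist_comp_curve_le {f : X → ℝ}
    (hlip : ∀ x, ∃ c : ℝ≥0, ∃ U ∈ 𝓝 x, LipschitzOnWith c f U) (γ : C(I, X)) :
    ∃ L : ℝ≥0, ∃ η > 0, ∀ s t : I, dist s t < η →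
      edist (f (γ s)) (f (γ t)) ≤ L * edist (γ s) (γ t) := by
  obtain ⟨L, hL⟩ : ∃ L : ℝ≥0, ∀ t ∈ (univ : Set I), ∀ᶠ q : I × I in 𝓝 (t, t),
      edist (f (γ q.1)) (f (γ q.2)) ≤ L * edist (γ q.1) (γ q.2) := by
    refine isCompact_univ.induction_on (p := fun S : Set I => ∃ L : ℝ≥0, ∀ t ∈ S,
      ∀ᶠ q : I × I in 𝓝 (t, t), edist (f (γ q.1)) (f (γ q.2)) ≤ L * edist (γ q.1) (γ q.2))
      ⟨0, by simp⟩ ?_ ?_ ?_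
    · rintro S T hST ⟨L, hL⟩
      exact ⟨L, fun t ht => hL t (hST ht)⟩
    · rintro S T ⟨L, hL⟩ ⟨L', hL'⟩
      refine ⟨max L L', fun t ht => ?_⟩
      rcases ht with ht | ht
      · filter_upwards [hL t ht] with q hq
        exact hq.trans (by gcongr; exact le_max_left _ _)
      · filter_upwards [hL' t ht] with q hq
        exact hq.trans (by gcongr; exact le_max_right _ _)
    · intro t _
      obtain ⟨c, U, hU, hc⟩ := hlip (γ t)
      have h1 : ∀ᶠ s in 𝓝 t, U ∈ 𝓝 (γ s) :=
        γ.continuous.continuousAt.eventually (eventually_mem_nhds_iff.2 hU)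
      refine ⟨_, nhdsWithin_le_nhds h1, c, fun s hs => ?_⟩
      have h2 : ∀ᶠ r in 𝓝 s, γ r ∈ U := γ.continuous.continuousAt hs
      rw [nhds_prod_eq]
      filter_upwards [h2.prod_mk h2] with q hq using hc hq.1 hq.2
  have h := mem_nhdsSet_iff_forall.2 (fun p (hp : p ∈ diagonal I) => by
    have := hL p.1 trivial
    rw [show (p.1, p.1) = p from Prod.ext rfl hp] at this
    exact this)
  rw [nhdsSet_diagonal_eq_uniformity, Metric.mem_uniformity_dist] at h
  obtain ⟨η, hη, h⟩ := h
  exact ⟨L, η, hη, fun s t hst => h hst⟩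

/-- The composition of a locally Lipschitz function with an absolutely continuous curve is
absolutely continuous: at small scales its increments are bounded by those of a primitive of the
function that controls the curve. -/
lemma absolutelyContinuousOnInterval_comp_curve {f : X → ℝ}
    (hlip : ∀ x, ∃ c : ℝ≥0, ∃ U ∈ 𝓝 x, LipschitzOnWith c f U) {γ : C(I, X)}
    (hγ : IsAbsolutelyContinuousCurve γ) :
    AbsolutelyContinuousOnInterval (fun t => f (γ (projIcc 0 1 zero_le_one t))) 0 1 := by
  obtain ⟨m, hm, hmfin, hmle⟩ := hγ
  obtain ⟨L, η, hη, hL⟩ := exists_edist_comp_curve_le hlip γ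
  set m' : ℝ → ℝ≥0∞ := fun x => m (projIcc 0 1 zero_le_one x) with hm'
  have hm'meas : Measurable m' := hm.comp continuous_projIcc.measurable
  have hm'eq : ∀ r : I, m' r = m r := fun r => by simp [hm']
  have hint : IntegrableOn (fun x => (m' x).toReal) (Icc 0 1) := by
    refine integrable_toReal_of_lintegral_ne_top hm'meas.aemeasurable ?_
    rw [← lintegral_unitInterval]
    simpa only [hm'eq] using hmfin.ne
  have hii : IntervalIntegrable (fun x => (m' x).toReal) volume 0 1 :=
    (intervalIntegrable_iff_integrableOn_Icc_of_le zero_le_one).2 hint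
  have hV := hii.absolutelyContinuousOnInterval_intervalIntegral (c := 0) (by simp)
  have hbound : ∀ s t : I, s ≤ t → dist s t < η → dist (f (γ s)) (f (γ t)) ≤
      L * dist (∫ x in (0:ℝ)..s, (m' x).toReal) (∫ x in (0:ℝ)..t, (m' x).toReal) := by
    intro s t hst hd
    have hsub : Icc (s : ℝ) t ⊆ Icc 0 1 := Icc_subset_Icc s.2.1 t.2.2
    have h1 : edist (γ s) (γ t) ≤ ∫⁻ x in Icc (s : ℝ) t, m' x := by
      rw [← lintegral_Icc_unitInterval]
      simpa only [hm'eq] using hmle s t hst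
    have hfin : ∫⁻ x in Icc (s : ℝ) t, m' x ≠ ⊤ := by
      refine ((lintegral_mono_set hsub).trans_lt ?_).ne
      rw [← lintegral_unitInterval]
      simpa only [hm'eq] using hmfin
    have hae : ∀ᵐ x ∂(volume.restrict (Icc (s : ℝ) t)), m' x < ⊤ := ae_lt_top hm'meas hfin
    have hi : ∀ r : I, IntervalIntegrable (fun x => (m' x).toReal) volume 0 r := fun r =>
      (intervalIntegrable_iff_integrableOn_Icc_of_le r.2.1).2
        (hint.mono_set (Icc_subset_Icc le_rfl r.2.2))
    have h2 : dist (∫ x in (0:ℝ)..s, (m' x).toReal) (∫ x in (0:ℝ)..t, (m' x).toReal) =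
        (∫⁻ x in Icc (s : ℝ) t, m' x).toReal := by
      rw [dist_comm, Real.dist_eq, intervalIntegral.integral_interval_sub_left (hi t) (hi s),
        intervalIntegral.integral_of_le hst, ← integral_Icc_eq_integral_Ioc,
        integral_toReal hm'meas.aemeasurable hae, abs_of_nonneg ENNReal.toReal_nonneg]
    have h3 := hL s t hd
    have h4 : edist (f (γ s)) (f (γ t)) ≤ L * ∫⁻ x in Icc (s : ℝ) t, m' x :=
      h3.trans (by gcongr)
    rw [h2, dist_edist]
    have h5 := ENNReal.toReal_mono (ENNReal.mul_ne_top ENNReal.coe_ne_top hfin) h4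
    simpa using h5
  have hbound' : ∀ s t : ℝ, s ∈ Icc (0:ℝ) 1 → t ∈ Icc (0:ℝ) 1 → dist s t < η →
      dist (f (γ (projIcc 0 1 zero_le_one s))) (f (γ (projIcc 0 1 zero_le_one t))) ≤
      L * dist (∫ x in (0:ℝ)..s, (m' x).toReal) (∫ x in (0:ℝ)..t, (m' x).toReal) := by
    intro s t hs ht hd
    rw [projIcc_of_mem _ hs, projIcc_of_mem _ ht]
    rcases le_total s t with h | h
    · exact hbound ⟨s, hs⟩ ⟨t, ht⟩ h hd
    · rw [dist_comm, dist_comm (∫ x in (0:ℝ)..s, (m' x).toReal)]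
      exact hbound ⟨t, ht⟩ ⟨s, hs⟩ h (by rw [dist_comm]; exact hd)
  rw [absolutelyContinuousOnInterval_iff] at hV ⊢
  intro ε hε
  obtain ⟨δ, hδ, hVδ⟩ := hV (ε / (L + 1)) (by positivity)
  refine ⟨min δ η, lt_min hδ hη, fun F hF hsum => ?_⟩
  have h1 := hVδ F hF (hsum.trans_le (min_le_left _ _))
  have h2 : ∑ i ∈ Finset.range F.1, dist (f (γ (projIcc 0 1 zero_le_one (F.2 i).1)))
      (f (γ (projIcc 0 1 zero_le_one (F.2 i).2))) ≤
      L * ∑ i ∈ Finset.range F.1, dist (∫ x in (0:ℝ)..(F.2 i).1, (m' x).toReal)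
        (∫ x in (0:ℝ)..(F.2 i).2, (m' x).toReal) := by
    rw [Finset.mul_sum]
    refine Finset.sum_le_sum fun i hi => ?_
    have hmem := hF.1 i hi
    rw [uIcc_of_le zero_le_one] at hmem
    refine hbound' _ _ hmem.1 hmem.2 (lt_of_le_of_lt ?_ (hsum.trans_le (min_le_right _ _)))
    exact Finset.single_le_sum (f := fun i => dist (F.2 i).1 (F.2 i).2)
      (fun _ _ => dist_nonneg) hi
  have hS : 0 ≤ ∑ i ∈ Finset.range F.1, dist (∫ x in (0:ℝ)..(F.2 i).1, (m' x).toReal)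
        (∫ x in (0:ℝ)..(F.2 i).2, (m' x).toReal) := Finset.sum_nonneg fun _ _ => dist_nonneg
  have h3 := (lt_div_iff₀ (by positivity : (0:ℝ) < L + 1)).1 h1
  nlinarith

/-- The upper gradient inequality along an absolutely continuous curve of finite energy. -/
lemma enorm_sub_le_lintegral_of_lipschitzOnWith {f : X → ℝ} {g : X → ℝ≥0}
    (hlip : ∀ x, ∀ c : ℝ≥0, g x < c → ∃ U ∈ 𝓝 x, LipschitzOnWith c f U) {γ : C(I, X)}
    (hγ : IsAbsolutelyContinuousCurve γ) (henergy : ∫⁻ t, metricSpeed γ t ^ 2 < ⊤) :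
    ‖f (γ 1) - f (γ 0)‖ₑ ≤ ∫⁻ t, g (γ t) * metricSpeed γ t := by
  set u : ℝ → ℝ := fun t => f (γ (projIcc 0 1 zero_le_one t)) with hu
  have hlip' : ∀ x, ∃ c : ℝ≥0, ∃ U ∈ 𝓝 x, LipschitzOnWith c f U := fun x =>
    ⟨g x + 1, hlip x _ (lt_add_one _)⟩
  have hac : AbsolutelyContinuousOnInterval u 0 1 :=
    absolutelyContinuousOnInterval_comp_curve hlip' hγ
  have huI : ∀ s : I, u s = f (γ s) := fun s => by simp [hu]
  have h0 : u 0 = f (γ 0) := huI 0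
  have h1 : u 1 = f (γ 1) := huI 1
  rw [← h0, ← h1, ← hac.integral_deriv_eq_sub, intervalIntegral.integral_of_le zero_le_one,
    ← integral_Icc_eq_integral_Ioc]
  refine (enorm_integral_le_lintegral_enorm _).trans ?_
  rw [← lintegral_unitInterval (fun x => ‖deriv u x‖ₑ)]
  have hspeed : ∀ᵐ t : I, metricSpeed γ t ^ 2 < ⊤ :=
    ae_lt_top ((measurable_metricSpeed_right γ).pow_const 2) henergy.ne
  refine lintegral_mono_ae ?_
  filter_upwards [hspeed, ae_unitInterval_of_ae hac.ae_differentiableAt] with t ht hdiff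
  have hd : DifferentiableAt ℝ u t := hdiff (by rw [uIcc_of_le zero_le_one]; exact t.2)
  exact enorm_deriv_le_mul_metricSpeed (hlip (γ t)) huI hd.hasDerivAt
    (by simpa using ht)

/-- An upper semicontinuous function is bounded along a curve, so that its integral along a curve
of finite energy is finite. -/
lemma lintegral_mul_metricSpeed_lt_top {g : X → ℝ≥0} (hg : UpperSemicontinuous g) {γ : C(I, X)}
    (henergy : ∫⁻ t, metricSpeed γ t ^ 2 < ⊤) :
    ∫⁻ t, g (γ t) * metricSpeed γ t < ⊤ := by
  have husc : UpperSemicontinuousOn (g ∘ γ) univ :=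
    (hg.comp γ.continuous).upperSemicontinuousOn _
  obtain ⟨K, hK⟩ := husc.bddAbove_of_isCompact isCompact_univ
  calc ∫⁻ t, g (γ t) * metricSpeed γ t ≤ ∫⁻ t, K * (1 + metricSpeed γ t ^ 2) := by
        refine lintegral_mono fun t => ?_
        have h1 : (g (γ t) : ℝ≥0∞) ≤ K := by
          exact_mod_cast hK (mem_image_of_mem _ (mem_univ t))
        have h2 : metricSpeed γ t ≤ 1 + metricSpeed γ t ^ 2 := by
          rcases le_total (metricSpeed γ t) 1 with h | h
          · exact h.trans le_self_add
          · exact (le_self_pow₀ h two_ne_zero).trans le_add_self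
        gcongr
    _ = K * (1 + ∫⁻ t, metricSpeed γ t ^ 2) := by
        rw [lintegral_const_mul' _ _ ENNReal.coe_ne_top, lintegral_add_left measurable_const]
        simp
    _ < ⊤ := ENNReal.mul_lt_top ENNReal.coe_lt_top (ENNReal.add_lt_top.2 ⟨by simp, henergy⟩)

end Pointwise

/-! ### Test plans -/

section TestPlan

variable {X : Type*} [PseudoEMetricSpace X] [MeasurableSpace X] {m : Measure X}
  {P : Measure C(I, X)} {f : X → ℝ}

lemma IsTestPlan.ae_energy_lt_top (hP : IsTestPlan m P) :
    ∀ᵐ γ ∂P, ∫⁻ t, metricSpeed γ t ^ 2 < ⊤ :=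
  ae_lt_top ((measurable_metricSpeed.pow_const 2).lintegral_prod_right') hP.finite_energy.ne

lemma IsCurvewiseWeakUpperGradient.isWeakUpperGradient {G : X → ℝ≥0∞}
    (hG : IsCurvewiseWeakUpperGradient m f G)
    (hfin : ∀ P : Measure C(I, X), IsTestPlan m P →
      ∫⁻ γ, (∫⁻ t, G (γ t) * metricSpeed γ t) ∂P < ⊤) : IsWeakUpperGradient m f G :=
  ⟨hG.aemeasurable, fun P hP => lintegral_mono_ae (hG.ae_le_lintegral P hP), hfin⟩

variable [BorelSpace X]

lemma measurable_curve_eval (t : I) : Measurable (fun γ : C(I, X) => γ t) :=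
  (continuous_eval_const t).measurable

lemma measurable_curve_uncurry : Measurable (fun p : C(I, X) × I => p.1 p.2) :=
  (continuous_eval (F := C(I, X))).measurable

lemma IsTestPlan.measure_eval_eq_zero (hP : IsTestPlan m P) {s : Set X} (hs : MeasurableSet s)
    (h0 : m s = 0) (t : I) : P {γ | γ t ∈ s} = 0 := by
  obtain ⟨C, hC⟩ := hP.bounded_compression
  have h := hC t s
  rw [Measure.map_apply (measurable_curve_eval t) hs] at h
  have h' : (C • m) s = 0 := by simp [h0]
  exact le_antisymm (h.trans h'.le) bot_le

/-- The evaluation map does not charge `m`-null sets, by bounded compression. -/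
lemma IsTestPlan.quasiMeasurePreserving_eval (hP : IsTestPlan m P) :
    Measure.QuasiMeasurePreserving (fun p : C(I, X) × I => p.1 p.2) (P.prod volume) m := by
  have := hP.isProbabilityMeasure
  refine ⟨measurable_curve_uncurry, Measure.AbsolutelyContinuous.mk fun s hs h0 => ?_⟩
  rw [Measure.map_apply measurable_curve_uncurry hs,
    Measure.prod_apply_symm (measurable_curve_uncurry hs)]
  refine (lintegral_congr fun t => ?_).trans lintegral_zero
  exact hP.measure_eval_eq_zero hs h0 t

lemma IsTestPlan.ae_ae (hP : IsTestPlan m P) {p : X → Prop} (h : ∀ᵐ x ∂m, p x) :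
    ∀ᵐ γ ∂P, ∀ᵐ t : I, p (γ t) :=
  Measure.ae_ae_of_ae_prod (hP.quasiMeasurePreserving_eval.ae h)

lemma IsTestPlan.lintegral_eval_lt_top (hP : IsTestPlan m P) {g : X → ℝ≥0∞} (hg : Measurable g)
    (hfin : ∫⁻ x, g x ∂m < ⊤) : ∫⁻ γ, (∫⁻ t, g (γ t)) ∂P < ⊤ := by
  have := hP.isProbabilityMeasure
  obtain ⟨C, hC⟩ := hP.bounded_compression
  rw [lintegral_lintegral_swap (f := fun (γ : C(I, X)) (t : I) => g (γ t))
    (hg.comp measurable_curve_uncurry).aemeasurable]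
  have h : ∀ t : I, ∫⁻ γ, g (γ t) ∂P ≤ C * ∫⁻ x, g x ∂m := by
    intro t
    rw [← lintegral_map hg (measurable_curve_eval t)]
    refine (lintegral_mono' (hC t) le_rfl).trans_eq ?_
    rw [lintegral_smul_measure]
    rfl
  refine (lintegral_mono h).trans_lt ?_
  simpa using ENNReal.mul_lt_top ENNReal.coe_lt_top hfin

lemma IsTestPlan.aemeasurable_lintegral_mul_metricSpeed (hP : IsTestPlan m P) {G : X → ℝ≥0∞}
    (hG : AEMeasurable G m) : AEMeasurable (fun γ => ∫⁻ t, G (γ t) * metricSpeed γ t) P :=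
  ((hG.comp_quasiMeasurePreserving hP.quasiMeasurePreserving_eval).mul
    measurable_metricSpeed.aemeasurable).lintegral_prod_right'

/-- Conditioning a test plan on a set of curves of positive measure gives a test plan. -/
lemma IsTestPlan.cond (hP : IsTestPlan m P) {S : Set C(I, X)} (hS0 : P S ≠ 0) :
    IsTestPlan m ((P S)⁻¹ • P.restrict S) := by
  have := hP.isProbabilityMeasure
  have hinv : (P S)⁻¹ ≠ ⊤ := ENNReal.inv_ne_top.2 hS0
  have hac : (P S)⁻¹ • P.restrict S ≪ P :=
    Measure.restrict_le_self.absolutelyContinuous.smul_left _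
  refine ⟨⟨?_⟩, ?_, hac.ae_le hP.ae_absolutelyContinuous, ?_⟩
  · simp [ENNReal.inv_mul_cancel hS0 (measure_ne_top P S)]
  · obtain ⟨C, hC⟩ := hP.bounded_compression
    refine ⟨(P S)⁻¹.toNNReal * C, fun t => ?_⟩
    rw [Measure.map_smul]
    intro s
    have h1 : (P.restrict S).map (fun γ => γ t) s ≤ (C • m) s :=
      (Measure.map_mono Measure.restrict_le_self (measurable_curve_eval t) s).trans (hC t s)
    calc ((P S)⁻¹ • (P.restrict S).map (fun γ => γ t)) s
        = (P S)⁻¹ * (P.restrict S).map (fun γ => γ t) s := rfl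
      _ ≤ (P S)⁻¹ * (C • m) s := by gcongr
      _ = (((P S)⁻¹.toNNReal * C) • m) s := by
        simp only [Measure.smul_apply, ENNReal.smul_def, smul_eq_mul, ENNReal.coe_mul,
          ENNReal.coe_toNNReal hinv, mul_assoc]
  · rw [lintegral_smul_measure]
    exact ENNReal.mul_lt_top hinv.lt_top
      ((lintegral_mono' Measure.restrict_le_self le_rfl).trans_lt hP.finite_energy)

/-- An integrated weak upper gradient is a curvewise one, since the integrated inequality can be
applied to all conditionings of a given test plan. -/
lemma IsWeakUpperGradient.isCurvewiseWeakUpperGradient (hf : Measurable f)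
    {G : X → ℝ≥0∞} (hG : IsWeakUpperGradient m f G) : IsCurvewiseWeakUpperGradient m f G := by
  refine ⟨hG.aemeasurable, fun P hP => ?_, fun P hP => ?_⟩
  · have := hP.isProbabilityMeasure
    have hmeas : Measurable (fun γ : C(I, X) => ‖f (γ 1) - f (γ 0)‖ₑ) :=
      ((hf.comp (measurable_curve_eval 1)).sub (hf.comp (measurable_curve_eval 0))).enorm
    refine ae_le_of_forall_setLIntegral_le_of_sigmaFinite hmeas fun S _ _ => ?_
    rcases eq_or_ne (P S) 0 with h0 | h0
    · simp [Measure.restrict_eq_zero.2 h0]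
    · have h := hG.le_lintegral _ (hP.cond h0)
      rw [lintegral_smul_measure, lintegral_smul_measure, smul_eq_mul, smul_eq_mul] at h
      exact (ENNReal.mul_le_mul_iff_right (ENNReal.inv_ne_zero.2 (measure_ne_top P S))
        (ENNReal.inv_ne_top.2 h0)).1 h
  · exact ae_lt_top' (hP.aemeasurable_lintegral_mul_metricSpeed hG.aemeasurable)
      (hG.lintegral_lt_top P hP).ne

/-- Changing a curvewise weak upper gradient on a null set gives a curvewise weak upper gradient. -/
lemma IsCurvewiseWeakUpperGradient.congr {G G' : X → ℝ≥0∞}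
    (hG : IsCurvewiseWeakUpperGradient m f G) (h : G =ᵐ[m] G') :
    IsCurvewiseWeakUpperGradient m f G' := by
  have key : ∀ P : Measure C(I, X), IsTestPlan m P → ∀ᵐ γ ∂P,
      ∫⁻ t, G (γ t) * metricSpeed γ t = ∫⁻ t, G' (γ t) * metricSpeed γ t := by
    intro P hP
    filter_upwards [hP.ae_ae h] with γ hγ
    refine lintegral_congr_ae ?_
    filter_upwards [hγ] with t ht
    rw [ht]
  refine ⟨hG.aemeasurable.congr h, fun P hP => ?_, fun P hP => ?_⟩
  · filter_upwards [key P hP, hG.ae_le_lintegral P hP] with γ h1 h2 using h1 ▸ h2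
  · filter_upwards [key P hP, hG.ae_lintegral_lt_top P hP] with γ h1 h2 using h1 ▸ h2

/-- An upper semicontinuous bound of the local Lipschitz constant is a weak upper gradient. -/
lemma isCurvewiseWeakUpperGradient_of_lipschitzOnWith {g : X → ℝ≥0} (hg : UpperSemicontinuous g)
    (hlip : ∀ x, ∀ c : ℝ≥0, g x < c → ∃ U ∈ 𝓝 x, LipschitzOnWith c f U) :
    IsCurvewiseWeakUpperGradient m f (fun x => (g x : ℝ≥0∞)) := by
  refine ⟨hg.measurable.coe_nnreal_ennreal.aemeasurable, fun P hP => ?_, fun P hP => ?_⟩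
  · filter_upwards [hP.ae_absolutelyContinuous, hP.ae_energy_lt_top] with γ h1 h2
      using enorm_sub_le_lintegral_of_lipschitzOnWith hlip h1 h2
  · filter_upwards [hP.ae_energy_lt_top] with γ h2
      using lintegral_mul_metricSpeed_lt_top hg h2

lemma IsTestPlan.lintegral_mul_metricSpeed_mono (hP : IsTestPlan m P) {G G' : X → ℝ≥0∞}
    (h : G ≤ᵐ[m] G') : ∫⁻ γ, (∫⁻ t, G (γ t) * metricSpeed γ t) ∂P ≤
      ∫⁻ γ, (∫⁻ t, G' (γ t) * metricSpeed γ t) ∂P := by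
  refine lintegral_mono_ae ?_
  filter_upwards [hP.ae_ae h] with γ hγ
  refine lintegral_mono_ae ?_
  filter_upwards [hγ] with t ht
  gcongr

/-- A square integrable function has a finite integral along every test plan, by bounded
compression and the inequality `G |γ̇| ≤ G² + |γ̇|²`. -/
lemma IsTestPlan.lintegral_mul_metricSpeed_lt_top (hP : IsTestPlan m P) {G : X → ℝ≥0∞}
    (hG : Measurable G) (hfin : ∫⁻ x, G x ^ 2 ∂m < ⊤) :
    ∫⁻ γ, (∫⁻ t, G (γ t) * metricSpeed γ t) ∂P < ⊤ := by
  have hG2 : Measurable (fun x => G x ^ 2) := hG.pow_const 2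
  calc ∫⁻ γ, (∫⁻ t, G (γ t) * metricSpeed γ t) ∂P
      ≤ ∫⁻ γ, ((∫⁻ t, G (γ t) ^ 2) + ∫⁻ t, metricSpeed γ t ^ 2) ∂P := by
        refine lintegral_mono fun γ => ?_
        have hγ : Measurable (fun t => G (γ t) ^ 2) := hG2.comp γ.continuous.measurable
        rw [← lintegral_add_left hγ]
        refine lintegral_mono fun t => ?_
        rcases le_total (G (γ t)) (metricSpeed γ t) with h | h
        · calc G (γ t) * metricSpeed γ t ≤ metricSpeed γ t * metricSpeed γ t := by gcongr
            _ ≤ G (γ t) ^ 2 + metricSpeed γ t ^ 2 := by rw [← sq]; exact le_add_self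
        · calc G (γ t) * metricSpeed γ t ≤ G (γ t) * G (γ t) := by gcongr
            _ ≤ G (γ t) ^ 2 + metricSpeed γ t ^ 2 := by rw [← sq]; exact le_self_add
    _ = (∫⁻ γ, (∫⁻ t, G (γ t) ^ 2) ∂P) + ∫⁻ γ, (∫⁻ t, metricSpeed γ t ^ 2) ∂P :=
        lintegral_add_right _ ((measurable_metricSpeed.pow_const 2).lintegral_prod_right')
    _ < ⊤ := ENNReal.add_lt_top.2 ⟨hP.lintegral_eval_lt_top hG2 hfin, hP.finite_energy⟩

end TestPlan

/-! ### Null sets of the Riemannian volume, and differentiation on lines -/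

section ChartMeasurability

variable {n : ℕ} {M : Type*} [TopologicalSpace M] [MeasurableSpace M] [BorelSpace M]
  {φ : OpenPartialHomeomorph M (EuclideanSpace ℝ (Fin n))}

lemma aemeasurable_chart_symm {s : Set (EuclideanSpace ℝ (Fin n))} (hs : MeasurableSet s)
    (hsub : s ⊆ φ.target) : AEMeasurable φ.symm (volume.restrict s) :=
  (φ.continuousOn_symm.mono hsub).aemeasurable hs

lemma aemeasurable_chart_symm_withDensity (ρ : EuclideanSpace ℝ (Fin n) → ℝ≥0∞) :
    AEMeasurable φ.symm ((volume.restrict φ.target).withDensity ρ) :=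
  (aemeasurable_chart_symm φ.open_target.measurableSet subset_rfl).mono_ac
    (withDensity_absolutelyContinuous _ _)

end ChartMeasurability

section Volume

variable {n : ℕ} {M : Type*} [TopologicalSpace M] [ChartedSpace (EuclideanSpace ℝ (Fin n)) M]
  [RiemannianBundle (fun x : M => TangentSpace (𝓡 n) x)] [MeasurableSpace M]

/-- A measurable set that is null for the volume of every chart is null for the Riemannian volume,
although the atlas may be uncountable: the measure that is infinite on every set meeting the
complement, and zero on subsets of the given set, dominates all the chart volumes. -/
lemma riemannianVolume_eq_zero {N : Set M} (hN : MeasurableSet N)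
    (h : ∀ φ ∈ atlas (EuclideanSpace ℝ (Fin n)) M, chartVolume φ N = 0) :
    riemannianVolume n M N = 0 := by
  have hle : riemannianVolume n M ≤ ((⊤ : ℝ≥0∞) • Measure.count).restrict Nᶜ := by
    refine iSup₂_le fun φ hφ => Measure.le_iff.2 fun s hs => ?_
    rw [Measure.restrict_apply hs]
    rcases (s ∩ Nᶜ).eq_empty_or_nonempty with he | he
    · have hsub : s ⊆ N := fun x hx => by_contra fun hxN => he.le ⟨hx, hxN⟩
      simp [measure_mono_null hsub (h φ hφ)]
    · have h0 : Measure.count (s ∩ Nᶜ) ≠ 0 := (Measure.count_ne_zero he)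
      simp [ENNReal.top_mul h0]
  refine le_antisymm ((hle N).trans ?_) bot_le
  simp [Measure.restrict_apply hN]

variable [BorelSpace M] {φ : OpenPartialHomeomorph M (EuclideanSpace ℝ (Fin n))}

lemma chartVolume_eq_zero {N : Set M} (hN : MeasurableSet N)
    (h : ∀ᵐ y, y ∈ φ.target → φ.symm y ∉ N) : chartVolume φ N = 0 := by
  rw [chartVolume, Measure.map_apply_of_aemeasurable (aemeasurable_chart_symm_withDensity _) hN]
  refine withDensity_absolutelyContinuous _ _ ?_
  have h' := (ae_restrict_iff' φ.open_target.measurableSet).2 h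
  rw [ae_iff] at h'
  simp only [not_not] at h'
  exact h'

/-- A property of the points of `M` that is measurable and holds at almost every point of every
chart holds almost everywhere for the weighted volume. -/
lemma ae_weightedRiemannianVolume {h : M → ℝ} {p : M → Prop} (hp : MeasurableSet {x | p x})
    (hae : ∀ φ ∈ atlas (EuclideanSpace ℝ (Fin n)) M, ∀ᵐ y, y ∈ φ.target → p (φ.symm y)) :
    ∀ᵐ x ∂(weightedRiemannianVolume n h), p x := by
  refine withDensity_absolutelyContinuous _ _ ?_
  refine riemannianVolume_eq_zero hp.compl fun φ hφ => chartVolume_eq_zero hp.compl ?_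
  filter_upwards [hae φ hφ] with y hy hyt hn using hn (hy hyt)

variable [IsManifold (𝓡 n) ∞ M]
  [IsContinuousRiemannianBundle (EuclideanSpace ℝ (Fin n)) (fun x : M => TangentSpace (𝓡 n) x)]

/-- Locally in a chart the weighted volume dominates a multiple of the Lebesgue measure. -/
lemma eventually_map_volume_le_weightedRiemannianVolume {h : M → ℝ} (h_continuous : Continuous h)
    (h_pos : ∀ x, 0 < h x) (hφ : φ ∈ atlas (EuclideanSpace ℝ (Fin n)) M)
    {y : EuclideanSpace ℝ (Fin n)} (hy : y ∈ φ.target) :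
    ∃ C : ℝ≥0, ∀ᶠ r in 𝓝[>] (0 : ℝ),
      (volume.restrict (Metric.ball y r)).map φ.symm ≤ C • weightedRiemannianVolume n h := by
  have hd : ContinuousAt (fun z => √(chartGramMatrix φ z).det) y :=
    ((continuousOn_det_chartGramMatrix hφ).continuousAt (φ.open_target.mem_nhds hy)).sqrt
  have hd0 : 0 < √(chartGramMatrix φ y).det := Real.sqrt_pos.2 (det_chartGramMatrix_pos hφ hy)
  have hh : ContinuousAt (fun z => h (φ.symm z) ^ 2) y :=
    ((h_continuous.continuousAt).comp
      (φ.continuousOn_symm.continuousAt (φ.open_target.mem_nhds hy))).pow 2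
  have hh0 : 0 < h (φ.symm y) ^ 2 := pow_pos (h_pos _) 2
  obtain ⟨a, ha0, ha⟩ := exists_between hd0
  obtain ⟨b, hb0, hb⟩ := exists_between hh0
  have hnhds : ∀ᶠ z in 𝓝 y, z ∈ φ.target ∧ a < √(chartGramMatrix φ z).det ∧
      b < h (φ.symm z) ^ 2 :=
    Filter.Eventually.and (φ.open_target.mem_nhds hy) ((hd.eventually_const_lt ha).and (hh.eventually_const_lt hb))
  obtain ⟨δ, hδ, hball⟩ := Metric.eventually_nhds_iff_ball.1 hnhds
  set ρ : EuclideanSpace ℝ (Fin n) → ℝ≥0∞ := fun z => ENNReal.ofReal √(chartGramMatrix φ z).det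
    with hρ
  set W : Set M := {x | b < h x ^ 2} with hW
  have hWm : MeasurableSet W := (isOpen_lt continuous_const (h_continuous.pow 2)).measurableSet
  -- On the ball, `a` bounds the density `√|g|` and `b` bounds the weight `h²` from below.
  refine ⟨(Real.toNNReal b * Real.toNNReal a)⁻¹, ?_⟩
  filter_upwards [Ioo_mem_nhdsGT hδ] with r hr
  have hB : ∀ z ∈ Metric.ball y r, z ∈ φ.target ∧ a < √(chartGramMatrix φ z).det ∧
      b < h (φ.symm z) ^ 2 := fun z hz => hball z (Metric.ball_subset_ball hr.2.le hz)
  refine Measure.le_iff.2 fun s hs => ?_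
  have h1 : (volume.restrict (Metric.ball y r)).map φ.symm s =
      volume (φ.symm ⁻¹' s ∩ Metric.ball y r) := by
    rw [Measure.map_apply_of_aemeasurable
      (aemeasurable_chart_symm measurableSet_ball fun z hz => (hB z hz).1) hs,
      Measure.restrict_apply' measurableSet_ball]
  have h2 : ENNReal.ofReal b * chartVolume φ (s ∩ W) ≤ weightedRiemannianVolume n h s := by
    rw [weightedRiemannianVolume, withDensity_apply _ hs]
    calc ENNReal.ofReal b * chartVolume φ (s ∩ W)
        ≤ ENNReal.ofReal b * riemannianVolume n M (s ∩ W) := by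
          have hle : chartVolume φ ≤ riemannianVolume n M :=
            le_iSup₂ (f := fun φ (_ : φ ∈ atlas (EuclideanSpace ℝ (Fin n)) M) => chartVolume φ) φ hφ
          gcongr
      _ = ∫⁻ _ in s ∩ W, ENNReal.ofReal b ∂(riemannianVolume n M) := by simp
      _ ≤ ∫⁻ x in s ∩ W, ENNReal.ofReal (h x ^ 2) ∂(riemannianVolume n M) :=
          setLIntegral_mono' (hs.inter hWm) fun x hx => ENNReal.ofReal_le_ofReal hx.2.le
      _ ≤ ∫⁻ x in s, ENNReal.ofReal (h x ^ 2) ∂(riemannianVolume n M) :=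
          lintegral_mono_set inter_subset_left
  have h3 : ENNReal.ofReal a * volume (φ.symm ⁻¹' s ∩ Metric.ball y r) ≤
      chartVolume φ (s ∩ W) := by
    rw [chartVolume, Measure.map_apply_of_aemeasurable (aemeasurable_chart_symm_withDensity _)
      (hs.inter hWm)]
    have hsub : φ.symm ⁻¹' s ∩ Metric.ball y r ⊆ φ.symm ⁻¹' (s ∩ W) :=
      fun z hz => ⟨hz.1, (hB z hz.2).2.2⟩
    have hsubt : φ.symm ⁻¹' s ∩ Metric.ball y r ⊆ φ.target := fun z hz => (hB z hz.2).1
    calc ENNReal.ofReal a * volume (φ.symm ⁻¹' s ∩ Metric.ball y r)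
        = ∫⁻ _ in φ.symm ⁻¹' s ∩ Metric.ball y r, ENNReal.ofReal a := by simp
      _ ≤ ∫⁻ z in φ.symm ⁻¹' s ∩ Metric.ball y r, ρ z := by
          refine lintegral_mono_ae ?_
          have hmem : ∀ᵐ z ∂(volume.restrict (φ.symm ⁻¹' s ∩ Metric.ball y r)),
              z ∈ Metric.ball y r :=
            ae_mono (Measure.restrict_mono inter_subset_right le_rfl)
              (ae_restrict_mem measurableSet_ball)
          filter_upwards [hmem] with z hz using ENNReal.ofReal_le_ofReal (hB z hz).2.1.le
      _ = ∫⁻ z in φ.symm ⁻¹' s ∩ Metric.ball y r, ρ z ∂(volume.restrict φ.target) := by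
          rw [Measure.restrict_restrict_of_subset hsubt]
      _ ≤ ((volume.restrict φ.target).withDensity ρ) (φ.symm ⁻¹' s ∩ Metric.ball y r) :=
          withDensity_apply_le _ _
      _ ≤ ((volume.restrict φ.target).withDensity ρ) (φ.symm ⁻¹' (s ∩ W)) := measure_mono hsub
  rw [h1, Measure.smul_apply, ENNReal.smul_def, smul_eq_mul]
  have hne : Real.toNNReal b * Real.toNNReal a ≠ 0 :=
    mul_ne_zero (Real.toNNReal_pos.2 hb0).ne' (Real.toNNReal_pos.2 ha0).ne'
  rw [ENNReal.coe_inv hne, ENNReal.coe_mul, mul_comm, ← div_eq_mul_inv]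
  rw [ENNReal.le_div_iff_mul_le (Or.inl (by exact_mod_cast hne)) (Or.inl (by finiteness))]
  calc volume (φ.symm ⁻¹' s ∩ Metric.ball y r) * (ENNReal.ofReal b * ENNReal.ofReal a)
      = ENNReal.ofReal b * (ENNReal.ofReal a * volume (φ.symm ⁻¹' s ∩ Metric.ball y r)) := by ring
    _ ≤ ENNReal.ofReal b * chartVolume φ (s ∩ W) := by gcongr
    _ ≤ weightedRiemannianVolume n h s := h2

end Volume

section OneDimensional

/-- Monotonicity along the rational points forces a derivative to be nonnegative. -/
lemma nonneg_of_hasDerivAt_of_rat {Ψ : ℝ → ℝ} {a b d τ : ℝ} (hd : HasDerivAt Ψ d τ)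
    (hτ : τ ∈ Ioo a b)
    (hmono : ∀ p q : ℚ, a ≤ p → p < q → (q : ℝ) ≤ b → Ψ p ≤ Ψ q) : 0 ≤ d := by
  by_contra! hneg
  have h1 : ∀ᶠ x in 𝓝[≠] τ, slope Ψ τ x < 0 :=
    (hasDerivAt_iff_tendsto_slope.1 hd).eventually_lt_const hneg
  have h2 : ∀ᶠ x in 𝓝 τ, x ≠ τ → slope Ψ τ x < 0 := eventually_nhdsWithin_iff.1 h1
  obtain ⟨η, hη, hball⟩ := Metric.eventually_nhds_iff_ball.1
    (h2.and (Ioo_mem_nhds hτ.1 hτ.2))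
  obtain ⟨p, hp1, hp2⟩ := exists_rat_btwn (sub_lt_self τ hη)
  obtain ⟨q, hq1, hq2⟩ := exists_rat_btwn (lt_add_of_pos_right τ hη)
  have hp := hball p (by rw [Real.ball_eq_Ioo]; exact ⟨hp1, by linarith⟩)
  have hq := hball q (by rw [Real.ball_eq_Ioo]; exact ⟨by linarith, hq2⟩)
  have hps := hp.1 hp2.ne
  have hqs := hq.1 hq1.ne'
  rw [slope_def_field] at hps hqs
  have hp3 : Ψ τ < Ψ p := by
    by_contra! hle
    exact absurd hps (not_lt.2 (div_nonneg_of_nonpos (by linarith) (by linarith)))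
  have hq3 : Ψ q < Ψ τ := by
    by_contra! hle
    exact absurd hqs (not_lt.2 (div_nonneg (by linarith) (by linarith)))
  have := hmono p q hp.2.1.le (by exact_mod_cast hp2.trans hq1) hq.2.2.le
  linarith

/-- A function whose increments over the intervals with rational endpoints are bounded by the
integrals of `H` has a derivative bounded by `H` almost everywhere. -/
lemma ae_enorm_deriv_le_of_rat {F : ℝ → ℝ} {F' : ℝ → ℝ} {ε : ℝ}
    (hF : ∀ τ ∈ Ioo (-ε) ε, HasDerivAt F (F' τ) τ) {H : ℝ → ℝ≥0∞}
    (hH : AEMeasurable H (volume.restrict (Ioo (-ε) ε)))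
    (hfin : ∀ a b : ℚ, -ε < a → a < b → (b : ℝ) < ε → ∫⁻ τ in Icc (a : ℝ) b, H τ < ⊤)
    (hle : ∀ a b : ℚ, -ε < a → a < b → (b : ℝ) < ε →
      ‖F b - F a‖ₑ ≤ ∫⁻ τ in Icc (a : ℝ) b, H τ) :
    ∀ᵐ τ, τ ∈ Ioo (-ε) ε → ‖F' τ‖ₑ ≤ H τ := by
  -- It suffices to treat the countably many compact intervals with rational endpoints.
  have key : ∀ a b : ℚ, -ε < a → a < b → (b : ℝ) < ε →
      ∀ᵐ τ, τ ∈ Ioo (a : ℝ) b → ‖F' τ‖ₑ ≤ H τ := by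
    intro a b ha hab hb
    have habR : (a : ℝ) < b := by exact_mod_cast hab
    have hsub : Icc (a : ℝ) b ⊆ Ioo (-ε) ε := fun τ hτ => ⟨ha.trans_le hτ.1, hτ.2.trans_lt hb⟩
    have hHm : AEMeasurable H (volume.restrict (Icc (a : ℝ) b)) := hH.mono_set hsub
    have hHfin := hfin a b ha hab hb
    have hint : IntegrableOn (fun τ => (H τ).toReal) (Icc (a : ℝ) b) :=
      integrable_toReal_of_lintegral_ne_top hHm hHfin.ne
    have hii : IntervalIntegrable (fun τ => (H τ).toReal) volume a b :=
      (intervalIntegrable_iff_integrableOn_Icc_of_le habR.le).2 hint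
    have hlt : ∀ᵐ τ, τ ∈ Icc (a : ℝ) b → H τ < ⊤ :=
      (ae_restrict_iff' measurableSet_Icc).1 (ae_lt_top' hHm hHfin.ne)
    have hrat : ∀ p q : ℚ, (a : ℝ) ≤ p → p < q → (q : ℝ) ≤ b →
        |F q - F p| ≤ ∫ τ in (p : ℝ)..q, (H τ).toReal := by
      intro p q hp hpq hq
      have hpqR : (p : ℝ) < q := by exact_mod_cast hpq
      have hs : Icc (p : ℝ) q ⊆ Icc (a : ℝ) b := Icc_subset_Icc hp hq
      have h1 := hle p q (ha.trans_le hp) hpq (hq.trans_lt hb)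
      have h2 := hfin p q (ha.trans_le hp) hpq (hq.trans_lt hb)
      have hHm' := hHm.mono_set hs
      rw [intervalIntegral.integral_of_le hpqR.le, ← integral_Icc_eq_integral_Ioc,
        integral_toReal hHm' (ae_lt_top' hHm' h2.ne)]
      have h3 := ENNReal.toReal_mono h2.ne h1
      simpa using h3
    have hI : ∀ c ∈ Icc (a : ℝ) b, ∀ d ∈ Icc (a : ℝ) b,
        IntervalIntegrable (fun τ => (H τ).toReal) volume c d := fun c hc d hd =>
      hii.mono_set (by rw [uIcc_of_le habR.le]; exact uIcc_subset_Icc hc hd)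
    filter_upwards [hii.ae_hasDerivAt_integral, hlt] with τ hτ hτlt hτab
    have hτI : τ ∈ Icc (a : ℝ) b := Ioo_subset_Icc_self hτab
    set Φ : ℝ → ℝ := fun x => ∫ t in (a : ℝ)..x, (H t).toReal with hΦ
    have hΦd : HasDerivAt Φ (H τ).toReal τ :=
      hτ (by rw [uIcc_of_le habR.le]; exact hτI) a left_mem_uIcc
    have hFd : HasDerivAt F (F' τ) τ := hF τ (hsub hτI)
    have hΦrat : ∀ p q : ℚ, (a : ℝ) ≤ p → p < q → (q : ℝ) ≤ b → |F q - F p| ≤ Φ q - Φ p := by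
      intro p q hp hpq hq
      have hpqR : (p : ℝ) < q := by exact_mod_cast hpq
      rw [hΦ, intervalIntegral.integral_interval_sub_left
        (hI a (left_mem_Icc.2 habR.le) q ⟨hp.trans hpqR.le, hq⟩)
        (hI a (left_mem_Icc.2 habR.le) p ⟨hp, hpqR.le.trans hq⟩)]
      exact hrat p q hp hpq hq
    -- Both `Φ - F` and `Φ + F` are nondecreasing along the rationals.
    have h1 : 0 ≤ (H τ).toReal - F' τ :=
      nonneg_of_hasDerivAt_of_rat (hΦd.sub hFd) hτab fun p q hp hpq hq => by
        have := (abs_le.1 (hΦrat p q hp hpq hq)).2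
        simp only [Pi.sub_apply]
        linarith
    have h2 : 0 ≤ (H τ).toReal + F' τ :=
      nonneg_of_hasDerivAt_of_rat (hΦd.add hFd) hτab fun p q hp hpq hq => by
        have := (abs_le.1 (hΦrat p q hp hpq hq)).1
        simp only [Pi.add_apply]
        linarith
    have h3 : |F' τ| ≤ (H τ).toReal := abs_le.2 ⟨by linarith, by linarith⟩
    rw [← ofReal_norm, ← ENNReal.ofReal_toReal (hτlt hτI).ne]
    exact ENNReal.ofReal_le_ofReal h3
  have hall : ∀ᵐ τ, ∀ a b : ℚ, -ε < a → a < b → (b : ℝ) < ε → τ ∈ Ioo (a : ℝ) b →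
      ‖F' τ‖ₑ ≤ H τ := by
    simp only [ae_all_iff]
    exact key
  filter_upwards [hall] with τ hτ hτε
  obtain ⟨a, ha1, ha2⟩ := exists_rat_btwn hτε.1
  obtain ⟨b, hb1, hb2⟩ := exists_rat_btwn hτε.2
  exact hτ a b ha1 (by exact_mod_cast ha2.trans hb1) hb2 ⟨ha2, hb1⟩

end OneDimensional

/-! ### Coordinate segments -/

section Line

variable {n : ℕ} {M : Type*} [EMetricSpace M] [ChartedSpace (EuclideanSpace ℝ (Fin n)) M]
  [IsManifold (𝓡 n) ∞ M] [RiemannianBundle (fun x : M => TangentSpace (𝓡 n) x)]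
  {φ : OpenPartialHomeomorph M (EuclideanSpace ℝ (Fin n))}

lemma hasDerivAt_add_smul (x v : EuclideanSpace ℝ (Fin n)) (τ : ℝ) :
    HasDerivAt (fun τ : ℝ => x + τ • v) v τ := by
  simpa using ((hasDerivAt_id τ).smul_const v).const_add x

/-- The length of a coordinate segment is controlled by its coordinate velocity. -/
lemma edist_chart_symm_add_smul_le [IsRiemannianManifold (𝓡 n) M]
    (hφ : φ ∈ atlas (EuclideanSpace ℝ (Fin n)) M) {x v : EuclideanSpace ℝ (Fin n)} {p q : ℝ}
    (hpq : p ≤ q) (hmem : ∀ τ ∈ Icc p q, x + τ • v ∈ φ.target) {κ : ℝ≥0∞}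
    (hκ : ∀ τ ∈ Icc p q, ‖coordVec φ (x + τ • v) v‖ₑ ≤ κ) :
    edist (φ.symm (x + p • v)) (φ.symm (x + q • v)) ≤ κ * ENNReal.ofReal (q - p) := by
  have hdist : ∀ a b : M, edist a b = riemannianEDist (𝓡 n) a b :=
    (inferInstance : IsRiemannianManifold (𝓡 n) M).out
  set ℓ : ℝ → M := fun τ => φ.symm (x + τ • v) with hℓ
  have hline : ContMDiff 𝓘(ℝ, ℝ) (𝓡 n) 1 (fun τ : ℝ => x + τ • v) := by
    rw [contMDiff_iff_contDiff]
    fun_prop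
  have hsm : ContMDiffOn 𝓘(ℝ, ℝ) (𝓡 n) 1 ℓ (Icc p q) :=
    (contMDiffOn_symm_of_mem_atlas hφ).comp hline.contMDiffOn hmem
  rw [hdist]
  refine (riemannianEDist_le_pathELength hsm rfl rfl hpq).trans ?_
  rw [pathELength_eq_lintegral_mfderiv_Icc]
  calc ∫⁻ τ in Icc p q, ‖mfderiv 𝓘(ℝ, ℝ) (𝓡 n) ℓ τ (1 : ℝ)‖ₑ
      ≤ ∫⁻ _ in Icc p q, κ := by
        refine setLIntegral_mono' measurableSet_Icc fun τ hτ => ?_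
        have h1 : MDifferentiableAt (𝓡 n) (𝓡 n) φ.symm (x + τ • v) :=
          (mdifferentiable_of_mem_chart_atlas hφ).symm.mdifferentiableAt (hmem τ hτ)
        have h2 : HasMFDerivAt 𝓘(ℝ, ℝ) (𝓡 n) (fun τ : ℝ => x + τ • v) τ
            (ContinuousLinearMap.toSpanSingleton ℝ v) :=
          (hasDerivAt_add_smul x v τ).hasFDerivAt.hasMFDerivAt
        have h3 : mfderiv 𝓘(ℝ, ℝ) (𝓡 n) ℓ τ (1 : ℝ) = coordVec φ (x + τ • v) v := by
          have h4 := (HasMFDerivAt.comp τ h1.hasMFDerivAt h2).mfderiv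
          have h5 : mfderiv 𝓘(ℝ, ℝ) (𝓡 n) ℓ τ = _ := h4
          rw [h5]
          change mfderiv (𝓡 n) (𝓡 n) φ.symm (x + τ • v) ((1 : ℝ) • v) = _
          rw [one_smul]
          rfl
        rw [h3]
        exact hκ τ hτ
    _ = κ * ENNReal.ofReal (q - p) := by simp

variable (φ) in
/-- The coordinate segment `t ↦ φ⁻¹(x + (a + t(b - a))v)`, as a function of the time and of its
base point `x`. -/
def coordSegment (v : EuclideanSpace ℝ (Fin n)) (a b : ℝ) (x : EuclideanSpace ℝ (Fin n)) (t : I) :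
    M :=
  φ.symm (x + (a + t * (b - a)) • v)

lemma affine_mem_Icc {a b : ℝ} (hab : a ≤ b) (t : I) : a + t * (b - a) ∈ Icc a b := by
  have h0 := t.2.1
  have h1 := t.2.2
  constructor <;> nlinarith

lemma edist_coordSegment_le [IsRiemannianManifold (𝓡 n) M]
    (hφ : φ ∈ atlas (EuclideanSpace ℝ (Fin n)) M) {x v : EuclideanSpace ℝ (Fin n)} {a b : ℝ}
    (hab : a ≤ b) {s t : I} {κ : ℝ≥0∞}
    (hmem : ∀ r ∈ uIcc s t, x + (a + r * (b - a)) • v ∈ φ.target)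
    (hκ : ∀ r ∈ uIcc s t, ‖coordVec φ (x + (a + (r : ℝ) * (b - a)) • v) v‖ₑ ≤ κ) :
    edist (coordSegment φ v a b x s) (coordSegment φ v a b x t) ≤
      κ * ENNReal.ofReal (b - a) * edist s t := by
  wlog hst : s ≤ t generalizing s t
  · rw [edist_comm, edist_comm s]
    rw [uIcc_comm] at hmem hκ
    exact this hmem hκ (le_of_not_ge hst)
  rw [uIcc_of_le hst] at hmem hκ
  rcases hab.eq_or_lt with rfl | hlt
  · simp [coordSegment]
  have hba : 0 < b - a := sub_pos.2 hlt
  have hst' : (s : ℝ) ≤ t := hst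
  have hle : a + s * (b - a) ≤ a + t * (b - a) := by gcongr
  have hex : ∀ τ ∈ Icc (a + s * (b - a)) (a + t * (b - a)),
      ∃ r ∈ Icc s t, τ = a + r * (b - a) := by
    intro τ hτ
    have h1 : (s : ℝ) ≤ (τ - a) / (b - a) := (le_div_iff₀ hba).2 (by linarith [hτ.1])
    have h2 : (τ - a) / (b - a) ≤ t := (div_le_iff₀ hba).2 (by linarith [hτ.2])
    refine ⟨⟨(τ - a) / (b - a), s.2.1.trans h1, h2.trans t.2.2⟩, ⟨h1, h2⟩, ?_⟩
    simp only
    field_simp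
    ring
  have h := edist_chart_symm_add_smul_le hφ hle (x := x) (v := v) (κ := κ)
    (fun τ hτ => by obtain ⟨r, hr, rfl⟩ := hex τ hτ; exact hmem r hr)
    (fun τ hτ => by obtain ⟨r, hr, rfl⟩ := hex τ hτ; exact hκ r hr)
  refine h.trans_eq ?_
  rw [mul_assoc, Subtype.edist_eq, edist_dist, dist_comm, Real.dist_eq,
    abs_of_nonneg (sub_nonneg.2 hst'), ← ENNReal.ofReal_mul hba.le]
  congr 2
  ring

variable [IsContinuousRiemannianBundle (EuclideanSpace ℝ (Fin n))
  (fun x : M => TangentSpace (𝓡 n) x)]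

/-- The metric speed of a coordinate segment is at most the norm of its velocity. -/
lemma metricSpeed_coordSegment_le [IsRiemannianManifold (𝓡 n) M]
    (hφ : φ ∈ atlas (EuclideanSpace ℝ (Fin n)) M) {x v : EuclideanSpace ℝ (Fin n)} {a b : ℝ}
    (hab : a < b) {γ : C(I, M)} (hγ : ∀ t, γ t = coordSegment φ v a b x t) {t : I}
    (ht : x + (a + t * (b - a)) • v ∈ φ.target) :
    metricSpeed γ t ≤
      ENNReal.ofReal (b - a) * ‖coordVec φ (x + (a + (t : ℝ) * (b - a)) • v) v‖ₑ := by
  have hc0 : ENNReal.ofReal (b - a) ≠ 0 := by simpa using hab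
  rw [mul_comm, ← ENNReal.div_le_iff hc0 ENNReal.ofReal_ne_top]
  refine le_of_forall_gt_imp_ge_of_dense fun κ hκ => ?_
  rw [ENNReal.div_le_iff hc0 ENNReal.ofReal_ne_top]
  have hcont : ContinuousAt (fun r : I => x + (a + r * (b - a)) • v) t := by fun_prop
  have h1 : ∀ᶠ r : I in 𝓝 t, x + (a + r * (b - a)) • v ∈ φ.target :=
    hcont (φ.open_target.mem_nhds ht)
  have h2 : ∀ᶠ r : I in 𝓝 t, ‖coordVec φ (x + (a + (r : ℝ) * (b - a)) • v) v‖ₑ < κ :=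
    Tendsto.eventually_lt_const hκ
      (ContinuousAt.comp (f := fun r : I => x + (a + (r : ℝ) * (b - a)) • v)
        (g := fun y => ‖coordVec φ y v‖ₑ)
        ((continuousOn_enorm_coordVec hφ v).continuousAt (φ.open_target.mem_nhds ht)) hcont)
  obtain ⟨η, hη, hball⟩ := Metric.eventually_nhds_iff_ball.1 (h1.and h2)
  refine limsup_le_of_le (by isBoundedDefault) ?_
  have hnear : ∀ᶠ s in 𝓝[≠] t, s ∈ Metric.ball t η :=
    nhdsWithin_le_nhds (Metric.ball_mem_nhds t hη)
  filter_upwards [hnear, self_mem_nhdsWithin] with s hs hst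
  have hsub : ∀ r ∈ uIcc s t, r ∈ Metric.ball t η := by
    intro r hr
    have h3 : |(r : ℝ) - t| ≤ |(s : ℝ) - t| := by
      have hr' : (r : ℝ) ∈ uIcc (s : ℝ) t := by
        rcases le_total s t with h | h
        · rw [uIcc_of_le h] at hr
          rw [uIcc_of_le (show (s : ℝ) ≤ t from h)]
          exact ⟨hr.1, hr.2⟩
        · rw [uIcc_of_ge h] at hr
          rw [uIcc_of_ge (show (t : ℝ) ≤ s from h)]
          exact ⟨hr.1, hr.2⟩
      rw [abs_sub_comm (s : ℝ)]
      rw [abs_sub_comm (r : ℝ)]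
      exact abs_sub_right_of_mem_uIcc hr'
    exact lt_of_le_of_lt h3 hs
  have hed : edist s t ≠ 0 := fun h => hst (edist_eq_zero.1 h)
  rw [ENNReal.div_le_iff hed (edist_ne_top _ _), hγ, hγ]
  exact edist_coordSegment_le hφ hab.le (fun r hr => (hball r (hsub r hr)).1)
    (fun r hr => (hball r (hsub r hr)).2.le)

end Line

/-! ### Plans of parallel segments -/

section SegmentPlan

variable {n : ℕ} {M : Type*} [EMetricSpace M]
  {φ : OpenPartialHomeomorph M (EuclideanSpace ℝ (Fin n))}
  {y v : EuclideanSpace ℝ (Fin n)} {r a b : ℝ}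

/-- The coordinate segments with direction `v` that start from the points of a closed ball. -/
def segmentFamily (φ : OpenPartialHomeomorph M (EuclideanSpace ℝ (Fin n)))
    (y v : EuclideanSpace ℝ (Fin n)) (r a b : ℝ) (hab : a ≤ b)
    (hmem : ∀ x ∈ Metric.closedBall y r, ∀ τ ∈ Icc a b, x + τ • v ∈ φ.target) :
    C(Metric.closedBall y r, C(I, M)) :=
  ContinuousMap.curry
    { toFun := fun p => coordSegment φ v a b p.1 p.2
      continuous_toFun := by
        refine φ.continuousOn_symm.comp_continuous (by fun_prop) fun p => ?_
        exact hmem p.1 p.1.2 _ (affine_mem_Icc hab p.2) }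

/-- The uniform distribution on a family of coordinate segments. -/
def segmentPlan (φ : OpenPartialHomeomorph M (EuclideanSpace ℝ (Fin n)))
    (y v : EuclideanSpace ℝ (Fin n)) (r a b : ℝ) (hab : a ≤ b)
    (hmem : ∀ x ∈ Metric.closedBall y r, ∀ τ ∈ Icc a b, x + τ • v ∈ φ.target) :
    Measure C(I, M) :=
  ((volume (Metric.closedBall y r))⁻¹ •
    (volume : Measure (EuclideanSpace ℝ (Fin n))).comap ((↑) : Metric.closedBall y r → _)).map
      (segmentFamily φ y v r a b hab hmem)

variable {hab : a ≤ b} {hmem : ∀ x ∈ Metric.closedBall y r, ∀ τ ∈ Icc a b, x + τ • v ∈ φ.target}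

lemma ae_of_ae_segmentPlan {p : C(I, M) → Prop}
    (h : ∀ᵐ γ ∂(segmentPlan φ y v r a b hab hmem), p γ) :
    ∀ᵐ x ∂volume, ∀ hx : x ∈ Metric.closedBall y r,
      p (segmentFamily φ y v r a b hab hmem ⟨x, hx⟩) := by
  have h1 := ae_of_ae_map (segmentFamily φ y v r a b hab hmem).continuous.measurable.aemeasurable h
  have hne : (volume (Metric.closedBall y r))⁻¹ ≠ 0 :=
    ENNReal.inv_ne_zero.2 measure_closedBall_lt_top.ne
  rw [Measure.ae_ennreal_smul_measure_iff hne, ae_iff,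
    comap_subtype_coe_apply Metric.isClosed_closedBall.measurableSet] at h1
  rw [ae_iff]
  refine measure_mono_null (fun x hx => ?_) h1
  simp only [mem_ofPred_eq, not_forall] at hx
  obtain ⟨hxB, hx⟩ := hx
  exact ⟨⟨x, hxB⟩, hx, rfl⟩

/-- The family of segments is compact, so that properties of all its members hold almost
everywhere for the plan, whether or not they are measurable. -/
lemma ae_segmentPlan_of_forall {p : C(I, M) → Prop}
    (h : ∀ x : Metric.closedBall y r, p (segmentFamily φ y v r a b hab hmem x)) :
    ∀ᵐ γ ∂(segmentPlan φ y v r a b hab hmem), p γ := by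
  have : CompactSpace (Metric.closedBall y r) :=
    isCompact_iff_compactSpace.1 (isCompact_closedBall y r)
  have hrange := (isCompact_range
    (segmentFamily φ y v r a b hab hmem).continuous).isClosed.measurableSet
  filter_upwards [ae_map_mem_range _ hrange _] with γ hγ
  obtain ⟨x, rfl⟩ := hγ
  exact h x

lemma isProbabilityMeasure_segmentPlan (hr : 0 < r) :
    IsProbabilityMeasure (segmentPlan φ y v r a b hab hmem) := by
  refine ⟨?_⟩
  rw [segmentPlan, Measure.map_apply (ContinuousMap.continuous _).measurable MeasurableSet.univ,
    preimage_univ, Measure.smul_apply,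
    comap_subtype_coe_apply Metric.isClosed_closedBall.measurableSet, image_univ,
    Subtype.range_coe, smul_eq_mul, ENNReal.inv_mul_cancel
      (Metric.measure_closedBall_pos volume y hr).ne' measure_closedBall_lt_top.ne]

/-- Evaluation of the plan at a fixed time is a translation in the chart. -/
lemma map_eval_segmentPlan_le [MeasurableSpace M] [BorelSpace M] {m : Measure M} (hr : 0 < r)
    {R : ℝ} (hR : Metric.ball y R ⊆ φ.target)
    (hseg : ∀ x ∈ Metric.closedBall y r, ∀ τ ∈ Icc a b, x + τ • v ∈ Metric.ball y R)
    {C : ℝ≥0} (hC : (volume.restrict (Metric.ball y R)).map φ.symm ≤ C • m) (t : I) :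
    (segmentPlan φ y v r a b hab hmem).map (fun γ => γ t) ≤
      ((volume (Metric.closedBall y r))⁻¹.toNNReal * C) • m := by
  refine Measure.le_iff.2 fun s hs => ?_
  have hB0 : volume (Metric.closedBall y r) ≠ 0 := (Metric.measure_closedBall_pos volume y hr).ne'
  set S : Set (Metric.closedBall y r) :=
    segmentFamily φ y v r a b hab hmem ⁻¹' ((fun γ : C(I, M) => γ t) ⁻¹' s) with hS
  have hP : (segmentPlan φ y v r a b hab hmem).map (fun γ => γ t) s =
      (volume (Metric.closedBall y r))⁻¹ * volume (Subtype.val '' S) := by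
    rw [Measure.map_apply (measurable_curve_eval t) hs, segmentPlan,
      Measure.map_apply (ContinuousMap.continuous _).measurable (measurable_curve_eval t hs),
      Measure.smul_apply, comap_subtype_coe_apply Metric.isClosed_closedBall.measurableSet,
      smul_eq_mul]
  have hsub : Subtype.val '' S ⊆
      (fun x => x + (a + t * (b - a)) • v) ⁻¹' (φ.symm ⁻¹' s ∩ Metric.ball y R) := by
    rintro _ ⟨x, hx, rfl⟩
    exact ⟨hx, hseg x x.2 _ (affine_mem_Icc hab t)⟩
  have h1 : volume (Subtype.val '' S) ≤ C * m s := by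
    refine (measure_mono hsub).trans ?_
    rw [measure_preimage_add_right]
    have h2 := hC s
    rw [Measure.map_apply_of_aemeasurable (aemeasurable_chart_symm measurableSet_ball hR) hs,
      Measure.restrict_apply' measurableSet_ball] at h2
    exact h2
  have h3 : (((volume (Metric.closedBall y r))⁻¹.toNNReal * C) • m) s =
      (volume (Metric.closedBall y r))⁻¹ * (C * m s) := by
    simp only [Measure.smul_apply, ENNReal.smul_def, smul_eq_mul, ENNReal.coe_mul,
      ENNReal.coe_toNNReal (ENNReal.inv_ne_top.2 hB0), mul_assoc]
  rw [hP, h3]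
  gcongr

variable [ChartedSpace (EuclideanSpace ℝ (Fin n)) M] [IsManifold (𝓡 n) ∞ M]
  [RiemannianBundle (fun x : M => TangentSpace (𝓡 n) x)]
  [IsRiemannianManifold (𝓡 n) M]

lemma edist_segmentFamily_le (hφ : φ ∈ atlas (EuclideanSpace ℝ (Fin n)) M) {K : ℝ≥0}
    (hK : ∀ x ∈ Metric.closedBall y r, ∀ τ ∈ Icc a b, ‖coordVec φ (x + τ • v) v‖ₑ ≤ K)
    (x : Metric.closedBall y r) (s t : I) :
    edist (segmentFamily φ y v r a b hab hmem x s) (segmentFamily φ y v r a b hab hmem x t) ≤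
      K * ENNReal.ofReal (b - a) * edist s t :=
  edist_coordSegment_le hφ hab (fun q _ => hmem x x.2 _ (affine_mem_Icc hab q))
    (fun q _ => hK x x.2 _ (affine_mem_Icc hab q))

/-- A family of coordinate segments of bounded speed is a test plan. -/
lemma isTestPlan_segmentPlan [MeasurableSpace M] [BorelSpace M] {m : Measure M}
    (hφ : φ ∈ atlas (EuclideanSpace ℝ (Fin n)) M) (hr : 0 < r) {R : ℝ}
    (hR : Metric.ball y R ⊆ φ.target)
    (hseg : ∀ x ∈ Metric.closedBall y r, ∀ τ ∈ Icc a b, x + τ • v ∈ Metric.ball y R)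
    {C : ℝ≥0} (hC : (volume.restrict (Metric.ball y R)).map φ.symm ≤ C • m)
    {K : ℝ≥0} (hK : ∀ z ∈ Metric.ball y R, ‖coordVec φ z v‖ₑ ≤ K) :
    IsTestPlan m (segmentPlan φ y v r a b hab hmem) := by
  have hcurve := edist_segmentFamily_le (hab := hab) (hmem := hmem) hφ
    fun x hx τ hτ => hK _ (hseg x hx τ hτ)
  have hprob := isProbabilityMeasure_segmentPlan (φ := φ) (v := v) (hab := hab) (hmem := hmem) hr
  refine ⟨hprob, ⟨_, map_eval_segmentPlan_le hr hR hseg hC⟩,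
    ae_segmentPlan_of_forall fun x => isAbsolutelyContinuousCurve_of_edist_le ?_ (hcurve x), ?_⟩
  · finiteness
  · have hle : ∀ᵐ γ ∂(segmentPlan φ y v r a b hab hmem),
        ∫⁻ t, metricSpeed γ t ^ 2 ≤ (K * ENNReal.ofReal (b - a)) ^ 2 := by
      refine ae_segmentPlan_of_forall fun x => ?_
      refine (lintegral_mono (g := fun _ => (K * ENNReal.ofReal (b - a)) ^ 2) fun t => ?_).trans ?_
      · have := metricSpeed_le_of_edist_le (hcurve x) t
        exact pow_le_pow_left' this 2
      · simp
    refine (lintegral_mono_ae hle).trans_lt ?_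
    simp only [lintegral_const, measure_univ, mul_one]
    finiteness

end SegmentPlan

/-! ### The increment of a function along parallel segments -/

section LowerBound

lemma lintegral_affine_unitInterval {a b : ℝ} (hab : a ≤ b) (H : ℝ → ℝ≥0∞) :
    ∫⁻ t : I, ENNReal.ofReal (b - a) * H (a + t * (b - a)) = ∫⁻ τ in Icc a b, H τ := by
  rw [lintegral_unitInterval (fun t => ENNReal.ofReal (b - a) * H (a + t * (b - a)))]
  have hmono : MonotoneOn (fun t : ℝ => a + t * (b - a)) (Icc 0 1) := fun s _ t _ hst => by
    have := sub_nonneg.2 hab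
    simp only
    gcongr
  have hderiv : ∀ t ∈ Icc (0 : ℝ) 1,
      HasDerivWithinAt (fun t : ℝ => a + t * (b - a)) (b - a) (Icc 0 1) t := fun t _ => by
    simpa using (((hasDerivAt_id t).mul_const (b - a)).const_add a).hasDerivWithinAt
  rw [← lintegral_image_eq_lintegral_deriv_mul_of_monotoneOn measurableSet_Icc hderiv hmono]
  congr 2
  have hc : ContinuousOn (fun t : ℝ => a + t * (b - a)) (Icc 0 1) := by fun_prop
  rw [hc.image_Icc_of_monotoneOn zero_le_one hmono]
  simp

variable {n : ℕ} {M : Type*} [EMetricSpace M] [ChartedSpace (EuclideanSpace ℝ (Fin n)) M]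
  [IsManifold (𝓡 n) ∞ M] [RiemannianBundle (fun x : M => TangentSpace (𝓡 n) x)]
  [IsContinuousRiemannianBundle (EuclideanSpace ℝ (Fin n)) (fun x : M => TangentSpace (𝓡 n) x)]
  [IsRiemannianManifold (𝓡 n) M] [MeasurableSpace M] [BorelSpace M]
  {φ : OpenPartialHomeomorph M (EuclideanSpace ℝ (Fin n))} {f : M → ℝ}
  {y v : EuclideanSpace ℝ (Fin n)}

/-- For almost every segment of a family of parallel segments, a weak upper gradient `G` controls
the increment of `f` and is integrable along the segment. The integrability needs a lower bound of
the metric speed, which comes from the chain rule and the lower bound of the derivative of `f`. -/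
lemma ae_enorm_sub_segment_le {m : Measure M} {G : M → ℝ≥0∞}
    (hf : ContMDiff (𝓡 n) 𝓘(ℝ, ℝ) 1 f) (hG : IsCurvewiseWeakUpperGradient m f G)
    (hφ : φ ∈ atlas (EuclideanSpace ℝ (Fin n)) M) {r R a b : ℝ} (hr : 0 < r) (hab : a < b)
    (hR : Metric.ball y R ⊆ φ.target)
    (hseg : ∀ x ∈ Metric.closedBall y r, ∀ τ ∈ Icc a b, x + τ • v ∈ Metric.ball y R)
    {C K L : ℝ≥0} (hC : (volume.restrict (Metric.ball y R)).map φ.symm ≤ C • m)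
    (hK : ∀ z ∈ Metric.ball y R, ‖coordVec φ z v‖ₑ ≤ K)
    (hL : ∀ z ∈ Metric.ball y R, ‖riemannianGradient (n := n) f (φ.symm z)‖₊ ≤ L)
    {d : ℝ} (hd0 : 0 < d) (hd : ∀ z ∈ Metric.ball y R, d ≤ |fderiv ℝ (f ∘ φ.symm) z v|) :
    ∀ᵐ x, x ∈ Metric.closedBall y r →
      ‖(f ∘ φ.symm) (x + b • v) - (f ∘ φ.symm) (x + a • v)‖ₑ ≤
        ∫⁻ τ in Icc a b, G (φ.symm (x + τ • v)) * ‖coordVec φ (x + τ • v) v‖ₑ ∧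
      ∫⁻ τ in Icc a b, G (φ.symm (x + τ • v)) * ‖coordVec φ (x + τ • v) v‖ₑ < ⊤ := by
  have hmem : ∀ x ∈ Metric.closedBall y r, ∀ τ ∈ Icc a b, x + τ • v ∈ φ.target :=
    fun x hx τ hτ => hR (hseg x hx τ hτ)
  have hP := isTestPlan_segmentPlan (hab := hab.le) (hmem := hmem) hφ hr hR hseg hC hK
  have h1 := ae_of_ae_segmentPlan (hG.ae_le_lintegral _ hP)
  have h2 := ae_of_ae_segmentPlan (hG.ae_lintegral_lt_top _ hP)
  filter_upwards [h1, h2] with x hx1 hx2 hx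
  replace hx1 := hx1 hx
  replace hx2 := hx2 hx
  set γ := segmentFamily φ y v r a b hab.le hmem ⟨x, hx⟩ with hγ
  have hγt : ∀ t : I, γ t = φ.symm (x + (a + t * (b - a)) • v) := fun _ => rfl
  have hγ0 : γ 0 = φ.symm (x + a • v) := by simp [hγt]
  have hγ1 : γ 1 = φ.symm (x + b • v) := by simp [hγt]
  set H : ℝ → ℝ≥0∞ := fun τ => G (φ.symm (x + τ • v)) * ‖coordVec φ (x + τ • v) v‖ₑ with hH
  have hball : ∀ t : I, x + (a + t * (b - a)) • v ∈ Metric.ball y R :=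
    fun t => hseg x hx _ (affine_mem_Icc hab.le t)
  rw [← lintegral_affine_unitInterval hab.le H]
  constructor
  · -- The increment only needs the upper bound of the metric speed.
    rw [hγ0, hγ1] at hx1
    refine hx1.trans (lintegral_mono fun t => ?_)
    have h3 := metricSpeed_coordSegment_le hφ (x := x) (v := v) hab (γ := γ) (t := t)
      (fun _ => rfl) (hR (hball t))
    calc G (γ t) * metricSpeed γ t
        ≤ G (γ t) * (ENNReal.ofReal (b - a) *
            ‖coordVec φ (x + (a + (t : ℝ) * (b - a)) • v) v‖ₑ) := by gcongr
      _ = ENNReal.ofReal (b - a) * H (a + t * (b - a)) := by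
          rw [hH, hγt]
          ring
  · -- The velocity is at most `K`, while `|∇f| |γ̇| ≥ |(f ∘ γ)'| ≥ (b - a) d`.
    set e : ℝ≥0∞ := ENNReal.ofReal ((b - a) * d) with he
    have he0 : e ≠ 0 := by
      simpa [he] using mul_pos (sub_pos.2 hab) hd0
    have hspeed : ∀ t, e ≤ L * metricSpeed γ t := by
      intro t
      have hfin : metricSpeed γ t < ⊤ :=
        (metricSpeed_le_of_edist_le (edist_segmentFamily_le (hab := hab.le) (hmem := hmem) hφ
          (fun x hx τ hτ => hK _ (hseg x hx τ hτ)) ⟨x, hx⟩) t).trans_lt (by finiteness)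
      have hline : HasDerivAt (fun t : ℝ => x + (a + t * (b - a)) • v) ((b - a) • v) t := by
        have h4 : HasDerivAt (fun t : ℝ => a + t * (b - a)) (b - a) t := by
          simpa using ((hasDerivAt_id (t : ℝ)).mul_const (b - a)).const_add a
        exact (h4.smul_const v).const_add x
      have hu : HasDerivAt (fun t : ℝ => (f ∘ φ.symm) (x + (a + t * (b - a)) • v))
          (fderiv ℝ (f ∘ φ.symm) (x + (a + (t : ℝ) * (b - a)) • v) ((b - a) • v)) t :=
        (differentiableAt_comp_chart_symm hf hφ (hR (hball t))).hasFDerivAt.comp_hasDerivAt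
          (t : ℝ) hline
      have h5 := enorm_deriv_le_mul_metricSpeed (γ := γ)
        (lipschitzOnWith_of_nnnorm_riemannianGradient_lt hf (γ t)) (fun s => rfl) hu hfin
      calc e ≤ ‖fderiv ℝ (f ∘ φ.symm) (x + (a + (t : ℝ) * (b - a)) • v) ((b - a) • v)‖ₑ := by
            rw [← ofReal_norm]
            refine ENNReal.ofReal_le_ofReal ?_
            rw [map_smul, norm_smul, Real.norm_of_nonneg (sub_pos.2 hab).le]
            exact mul_le_mul_of_nonneg_left (hd _ (hball t)) (sub_pos.2 hab).le
        _ ≤ ‖riemannianGradient (n := n) f (γ t)‖₊ * metricSpeed γ t := h5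
        _ ≤ L * metricSpeed γ t := by
            gcongr
            exact hL _ (hball t)
    calc ∫⁻ t : I, ENNReal.ofReal (b - a) * H (a + t * (b - a))
        ≤ ∫⁻ t : I, (ENNReal.ofReal (b - a) * K * e⁻¹ * L) * (G (γ t) * metricSpeed γ t) := by
          refine lintegral_mono fun t => ?_
          calc ENNReal.ofReal (b - a) * H (a + t * (b - a))
              ≤ ENNReal.ofReal (b - a) * (G (γ t) * K) := by
                simp only [hH, hγt]
                gcongr
                exact hK _ (hball t)
            _ = ENNReal.ofReal (b - a) * (G (γ t) * K) * (e⁻¹ * e) := by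
                rw [ENNReal.inv_mul_cancel he0 ENNReal.ofReal_ne_top, mul_one]
            _ ≤ ENNReal.ofReal (b - a) * (G (γ t) * K) * (e⁻¹ * (L * metricSpeed γ t)) := by
                gcongr
                exact hspeed t
            _ = (ENNReal.ofReal (b - a) * K * e⁻¹ * L) * (G (γ t) * metricSpeed γ t) := by ring
      _ = (ENNReal.ofReal (b - a) * K * e⁻¹ * L) * ∫⁻ t : I, G (γ t) * metricSpeed γ t :=
          lintegral_const_mul' _ _ (by have := ENNReal.inv_ne_top.2 he0; finiteness)
      _ < ⊤ := ENNReal.mul_lt_top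
          (by have := ENNReal.inv_ne_top.2 he0; finiteness) hx2

/-- A measurable set that meets almost every line of a given direction near `y` in a null set is
null near `y`. -/
lemma ae_notMem_ball_of_ae_ae_line {N : Set (EuclideanSpace ℝ (Fin n))} (hN : MeasurableSet N)
    {r ε : ℝ} (hε : 0 < ε) (hεv : ε * ‖v‖ ≤ r / 2)
    (h : ∀ᵐ x, x ∈ Metric.closedBall y r → ∀ᵐ τ : ℝ, τ ∈ Ioo (-ε) ε → x + τ • v ∉ N) :
    ∀ᵐ z, z ∈ Metric.ball y (r / 2) → z ∉ N := by
  have hmeas : MeasurableSet {p : EuclideanSpace ℝ (Fin n) × ℝ |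
      p.1 ∈ Metric.closedBall y r → p.2 ∈ Ioo (-ε) ε → p.1 + p.2 • v ∉ N} := by
    have h1 : MeasurableSet {p : EuclideanSpace ℝ (Fin n) × ℝ | p.1 ∈ Metric.closedBall y r} :=
      measurable_fst Metric.isClosed_closedBall.measurableSet
    have h2 : MeasurableSet {p : EuclideanSpace ℝ (Fin n) × ℝ | p.2 ∈ Ioo (-ε) ε} :=
      measurable_snd measurableSet_Ioo
    have h3 : MeasurableSet {p : EuclideanSpace ℝ (Fin n) × ℝ | p.1 + p.2 • v ∉ N} :=
      (show Measurable (fun p : EuclideanSpace ℝ (Fin n) × ℝ => p.1 + p.2 • v) by fun_prop) hN.compl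
    exact h1.imp (h2.imp h3)
  have h' : ∀ᵐ x, ∀ᵐ τ : ℝ, x ∈ Metric.closedBall y r → τ ∈ Ioo (-ε) ε → x + τ • v ∉ N := by
    filter_upwards [h] with x hx
    by_cases hxB : x ∈ Metric.closedBall y r
    · filter_upwards [hx hxB] with τ hτ _ using hτ
    · exact Eventually.of_forall fun τ hB => absurd hB hxB
  rw [Measure.ae_ae_comm hmeas] at h'
  -- By Fubini some translation by `τ • v` moves almost no point of the large ball into `N`, and the
  -- translate of the large ball contains the ball of half the radius.
  have hpos : volume (Ioo (-ε) ε) ≠ 0 := by simp [hε]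
  obtain ⟨τ, hτ, hτN⟩ : ∃ τ ∈ Ioo (-ε) ε,
      ∀ᵐ x, x ∈ Metric.closedBall y r → τ ∈ Ioo (-ε) ε → x + τ • v ∉ N := by
    by_contra hcon
    refine hpos (measure_mono_null (fun τ hτ => ?_) (ae_iff.1 h'))
    exact fun hall => hcon ⟨τ, hτ, hall⟩
  have hshift := (measurePreserving_add_right volume (-(τ • v))).quasiMeasurePreserving.ae hτN
  filter_upwards [hshift] with z hz hzball
  have hzB : z + -(τ • v) ∈ Metric.closedBall y r := by
    rw [mem_closedBall_iff_norm]
    rw [mem_ball_iff_norm] at hzball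
    have h1 : ‖τ • v‖ ≤ ε * ‖v‖ := by
      rw [norm_smul]
      exact mul_le_mul_of_nonneg_right (abs_le.2 ⟨hτ.1.le, hτ.2.le⟩) (norm_nonneg v)
    calc ‖z + -(τ • v) - y‖ = ‖(z - y) - τ • v‖ := by congr 1; abel
      _ ≤ ‖z - y‖ + ‖τ • v‖ := norm_sub_le _ _
      _ ≤ r := by linarith
  simpa using hz hzB hτ

end LowerBound

/-! ### Minimality of the gradient -/

section Minimality

variable {n : ℕ} {M : Type*} [EMetricSpace M] [ChartedSpace (EuclideanSpace ℝ (Fin n)) M]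
  [IsManifold (𝓡 n) ∞ M] [RiemannianBundle (fun x : M => TangentSpace (𝓡 n) x)]
  [IsContinuousRiemannianBundle (EuclideanSpace ℝ (Fin n)) (fun x : M => TangentSpace (𝓡 n) x)]
  [MeasurableSpace M] [BorelSpace M]
  {φ : OpenPartialHomeomorph M (EuclideanSpace ℝ (Fin n))} {f h : M → ℝ} {G : M → ℝ≥0∞}

lemma measurableSet_lt_enorm_fderiv (hf : ContMDiff (𝓡 n) 𝓘(ℝ, ℝ) 1 f) (hG : Measurable G)
    (hφ : φ ∈ atlas (EuclideanSpace ℝ (Fin n)) M) (v : EuclideanSpace ℝ (Fin n)) :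
    MeasurableSet {z | z ∈ φ.target ∧
      G (φ.symm z) * ‖coordVec φ z v‖ₑ < ‖fderiv ℝ (f ∘ φ.symm) z v‖ₑ} := by
  have h1 : Measurable (fun z : φ.target => ‖fderiv ℝ (f ∘ φ.symm) z v‖ₑ) :=
    (continuousOn_iff_continuous_domRestrict.1
      (continuousOn_enorm_fderiv_comp_chart_symm hf hφ v)).measurable
  have h2 : Measurable (fun z : φ.target => ‖coordVec φ (z : EuclideanSpace ℝ (Fin n)) v‖ₑ) :=
    (continuousOn_iff_continuous_domRestrict.1 (continuousOn_enorm_coordVec hφ v)).measurable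
  have h3 : Measurable (fun z : φ.target => G (φ.symm z)) :=
    hG.comp (continuousOn_iff_continuous_domRestrict.1 φ.continuousOn_symm).measurable
  have h4 := φ.open_target.measurableSet.subtype_image (measurableSet_lt (h3.mul h2) h1)
  convert h4 using 1
  ext z
  constructor
  · rintro ⟨hz, hlt⟩
    exact ⟨⟨z, hz⟩, hlt, rfl⟩
  · rintro ⟨z', hlt, rfl⟩
    exact ⟨z'.2, hlt⟩

variable [IsRiemannianManifold (𝓡 n) M]

/-- The local form of the bound of a directional derivative by a weak upper gradient. Along almost
every coordinate line in the direction `v` the bound holds by Lebesgue differentiation, and the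
lines fill a neighbourhood of `y`. -/
lemma ae_enorm_fderiv_le_nhds (h_continuous : Continuous h) (h_pos : ∀ x, 0 < h x)
    (hf : ContMDiff (𝓡 n) 𝓘(ℝ, ℝ) 1 f) (hGm : Measurable G)
    (hG : IsCurvewiseWeakUpperGradient (weightedRiemannianVolume n h) f G)
    (hφ : φ ∈ atlas (EuclideanSpace ℝ (Fin n)) M) {y v : EuclideanSpace ℝ (Fin n)}
    (hy : y ∈ φ.target) (hne : fderiv ℝ (f ∘ φ.symm) y v ≠ 0) :
    ∃ ρ > 0, ∀ᵐ z, z ∈ Metric.ball y ρ → ¬ (z ∈ φ.target ∧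
      G (φ.symm z) * ‖coordVec φ z v‖ₑ < ‖fderiv ℝ (f ∘ φ.symm) z v‖ₑ) := by
  obtain ⟨C, hC⟩ :=
    eventually_map_volume_le_weightedRiemannianVolume h_continuous h_pos hφ hy
  obtain ⟨d, hd0, hd⟩ := exists_between (abs_pos.2 hne)
  set K : ℝ≥0 := ‖coordVec φ y v‖₊ + 1 with hK
  set L : ℝ≥0 := ‖riemannianGradient (n := n) f (φ.symm y)‖₊ + 1 with hL
  have hnhds := φ.open_target.mem_nhds hy
  have e1 : ∀ᶠ z in 𝓝 y, d < |fderiv ℝ (f ∘ φ.symm) z v| :=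
    (((continuousOn_fderiv_comp_chart_symm hf hφ).clm_apply
      continuousOn_const).continuousAt hnhds).abs.eventually_const_lt hd
  have e2 : ∀ᶠ z in 𝓝 y, ‖coordVec φ z v‖ₑ < K :=
    Tendsto.eventually_lt_const (by
      rw [hK]
      exact ENNReal.coe_lt_coe.2 (lt_add_one ‖coordVec φ y v‖₊))
      ((continuousOn_enorm_coordVec hφ v).continuousAt hnhds)
  have e3 : ∀ᶠ z in 𝓝 y, ‖riemannianGradient (n := n) f (φ.symm z)‖ < L :=
    (φ.continuousOn_symm.continuousAt hnhds).eventually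
      (upperSemicontinuous_norm_riemannianGradient hf (φ.symm y) L (by simp [hL]))
  obtain ⟨δ, hδ, hball⟩ := Metric.eventually_nhds_iff_ball.1
    (Filter.Eventually.and hnhds (e1.and (e2.and e3)))
  obtain ⟨R, hRC, hR0, hRδ⟩ := (hC.and (Ioo_mem_nhdsGT hδ)).exists
  have hballR : ∀ z ∈ Metric.ball y R, z ∈ φ.target ∧ d < |fderiv ℝ (f ∘ φ.symm) z v| ∧
      ‖coordVec φ z v‖ₑ < K ∧ ‖riemannianGradient (n := n) f (φ.symm z)‖ < L :=
    fun z hz => hball z (Metric.ball_subset_ball hRδ.le hz)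
  have hr : 0 < R / 2 := half_pos hR0
  set ε : ℝ := R / 4 / (‖v‖ + 1) with hε
  have hvpos : 0 < ‖v‖ + 1 := by positivity
  have hε0 : 0 < ε := by positivity
  have hεv : ε * ‖v‖ ≤ R / 2 / 2 := by
    have h1 : ε * (‖v‖ + 1) = R / 4 := div_mul_cancel₀ _ hvpos.ne'
    nlinarith
  have hseg : ∀ x ∈ Metric.closedBall y (R / 2), ∀ τ ∈ Ioo (-ε) ε,
      x + τ • v ∈ Metric.ball y R := by
    intro x hx τ hτ
    rw [mem_closedBall_iff_norm] at hx
    rw [mem_ball_iff_norm]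
    have h1 : ‖τ • v‖ ≤ ε * ‖v‖ := by
      rw [norm_smul]
      exact mul_le_mul_of_nonneg_right (abs_le.2 ⟨hτ.1.le, hτ.2.le⟩) (norm_nonneg v)
    calc ‖x + τ • v - y‖ = ‖(x - y) + τ • v‖ := by congr 1; abel
      _ ≤ ‖x - y‖ + ‖τ • v‖ := norm_add_le _ _
      _ < R := by linarith
  refine ⟨R / 2 / 2, by positivity, ?_⟩
  refine ae_notMem_ball_of_ae_ae_line (measurableSet_lt_enorm_fderiv hf hGm hφ v) hε0 hεv ?_
  have hall : ∀ᵐ x, ∀ a b : ℚ, -ε < a → a < b → (b : ℝ) < ε →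
      x ∈ Metric.closedBall y (R / 2) →
      ‖(f ∘ φ.symm) (x + (b : ℝ) • v) - (f ∘ φ.symm) (x + (a : ℝ) • v)‖ₑ ≤
        ∫⁻ τ in Icc (a : ℝ) b, G (φ.symm (x + τ • v)) * ‖coordVec φ (x + τ • v) v‖ₑ ∧
      ∫⁻ τ in Icc (a : ℝ) b, G (φ.symm (x + τ • v)) * ‖coordVec φ (x + τ • v) v‖ₑ < ⊤ := by
    simp only [ae_all_iff]
    intro a b ha hab hb
    exact ae_enorm_sub_segment_le hf hG hφ hr (by exact_mod_cast hab)
      (fun z hz => (hballR z hz).1)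
      (fun x hx τ hτ => hseg x hx τ ⟨ha.trans_le hτ.1, hτ.2.trans_lt hb⟩) hRC
      (fun z hz => (hballR z hz).2.2.1.le)
      (fun z hz => (hballR z hz).2.2.2.le) hd0 (fun z hz => (hballR z hz).2.1.le)
  filter_upwards [hall] with x hx hxB
  have hline : ContinuousOn (fun τ : ℝ => x + τ • v) (Ioo (-ε) ε) := by fun_prop
  have hmaps : MapsTo (fun τ : ℝ => x + τ • v) (Ioo (-ε) ε) φ.target :=
    fun τ hτ => (hballR _ (hseg x hxB τ hτ)).1
  have hH : AEMeasurable (fun τ : ℝ => G (φ.symm (x + τ • v)) * ‖coordVec φ (x + τ • v) v‖ₑ)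
      (volume.restrict (Ioo (-ε) ε)) :=
    (hGm.comp_aemeasurable
      ((φ.continuousOn_symm.comp hline hmaps).aemeasurable measurableSet_Ioo)).mul
      (((continuousOn_enorm_coordVec hφ v).comp hline hmaps).aemeasurable measurableSet_Ioo)
  have hderiv : ∀ τ ∈ Ioo (-ε) ε, HasDerivAt (fun τ : ℝ => (f ∘ φ.symm) (x + τ • v))
      (fderiv ℝ (f ∘ φ.symm) (x + τ • v) v) τ := fun τ hτ =>
    (differentiableAt_comp_chart_symm hf hφ (hmaps hτ)).hasFDerivAt.comp_hasDerivAt τ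
      (hasDerivAt_add_smul x v τ)
  filter_upwards [ae_enorm_deriv_le_of_rat hderiv hH
    (fun a b ha hab hb => (hx a b ha hab hb hxB).2)
    (fun a b ha hab hb => (hx a b ha hab hb hxB).1)] with τ hτ hτε hlt
  exact absurd (hτ hτε) (not_le.2 hlt.2)

/-- A weak upper gradient bounds the derivative of `f` in a fixed direction, almost everywhere in
a chart. -/
lemma ae_enorm_fderiv_le (h_continuous : Continuous h) (h_pos : ∀ x, 0 < h x)
    (hf : ContMDiff (𝓡 n) 𝓘(ℝ, ℝ) 1 f) (hGm : Measurable G)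
    (hG : IsCurvewiseWeakUpperGradient (weightedRiemannianVolume n h) f G)
    (hφ : φ ∈ atlas (EuclideanSpace ℝ (Fin n)) M) (v : EuclideanSpace ℝ (Fin n)) :
    ∀ᵐ z, z ∈ φ.target →
      ‖fderiv ℝ (f ∘ φ.symm) z v‖ₑ ≤ G (φ.symm z) * ‖coordVec φ z v‖ₑ := by
  set N := {z | z ∈ φ.target ∧
      G (φ.symm z) * ‖coordVec φ z v‖ₑ < ‖fderiv ℝ (f ∘ φ.symm) z v‖ₑ} with hN
  -- At the points of `N` the derivative in the direction `v` does not vanish.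
  have hnull : volume N = 0 := by
    refine measure_null_of_locally_null _ fun y hy => ?_
    have hne : fderiv ℝ (f ∘ φ.symm) y v ≠ 0 := fun h0 => by
      have := hy.2
      simp [h0] at this
    obtain ⟨ρ, hρ, hae⟩ :=
      ae_enorm_fderiv_le_nhds h_continuous h_pos hf hGm hG hφ hy.1 hne
    refine ⟨N ∩ Metric.ball y ρ, inter_mem_nhdsWithin _ (Metric.ball_mem_nhds y hρ), ?_⟩
    refine measure_mono_null (fun z hz => ?_) (ae_iff.1 hae)
    exact fun hcon => hcon hz.2 hz.1
  filter_upwards [measure_eq_zero_iff_ae_notMem.1 hnull] with z hz hzt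
  exact not_lt.1 fun hlt => hz ⟨hzt, hlt⟩

/-- Every weak upper gradient is bounded below by `|∇f|`. -/
lemma IsCurvewiseWeakUpperGradient.enorm_riemannianGradient_le (h_continuous : Continuous h)
    (h_pos : ∀ x, 0 < h x) (hf : ContMDiff (𝓡 n) 𝓘(ℝ, ℝ) 1 f)
    (hG : IsCurvewiseWeakUpperGradient (weightedRiemannianVolume n h) f G) :
    (fun x => ‖riemannianGradient (n := n) f x‖ₑ) ≤ᵐ[weightedRiemannianVolume n h] G := by
  wlog hGm : Measurable G generalizing G
  · have hae := hG.aemeasurable.ae_eq_mk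
    exact (this (hG.congr hae) hG.aemeasurable.measurable_mk).trans hae.symm.le
  refine ae_weightedRiemannianVolume
    (measurableSet_le (measurable_enorm_riemannianGradient hf) hGm) fun φ hφ => ?_
  -- By continuity in the direction, a countable dense set of directions suffices.
  have hall : ∀ᵐ z, ∀ k : ℕ, z ∈ φ.target →
      ‖fderiv ℝ (f ∘ φ.symm) z (TopologicalSpace.denseSeq (EuclideanSpace ℝ (Fin n)) k)‖ₑ ≤
        G (φ.symm z) *
          ‖coordVec φ z (TopologicalSpace.denseSeq (EuclideanSpace ℝ (Fin n)) k)‖ₑ :=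
    ae_all_iff.2 fun k => ae_enorm_fderiv_le h_continuous h_pos hf hGm hG hφ _
  filter_upwards [hall] with z hz hzt
  rcases eq_or_ne (G (φ.symm z)) ⊤ with htop | htop
  · rw [htop]
    exact le_top
  · have hle : ‖riemannianGradient (n := n) f (φ.symm z)‖ ≤ (G (φ.symm z)).toReal := by
      refine norm_riemannianGradient_le hf hφ hzt ENNReal.toReal_nonneg fun v => ?_
      have hcont : Continuous (fun v => ‖coordVec φ z v‖) :=
        ((continuousOn_norm_coordVec hφ).comp_continuous (f := fun v => (z, v)) (by fun_prop)
          fun _ => ⟨hzt, trivial⟩)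
      refine (TopologicalSpace.denseRange_denseSeq (EuclideanSpace ℝ (Fin n))).induction_on
        (p := fun v => |fderiv ℝ (f ∘ φ.symm) z v| ≤ (G (φ.symm z)).toReal * ‖coordVec φ z v‖) v
        (isClosed_le (by fun_prop) (by fun_prop)) fun k => ?_
      have h1 := ENNReal.toReal_mono (by finiteness) (hz k hzt)
      rwa [ENNReal.toReal_mul, toReal_enorm, toReal_enorm, Real.norm_eq_abs] at h1
    rw [← ofReal_norm, ← ENNReal.ofReal_toReal htop]
    exact ENNReal.ofReal_le_ofReal hle

lemma isCurvewiseWeakUpperGradient_riemannianGradient (m : Measure M)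
    (hf : ContMDiff (𝓡 n) 𝓘(ℝ, ℝ) 1 f) :
    IsCurvewiseWeakUpperGradient m f (fun x => ‖riemannianGradient (n := n) f x‖ₑ) := by
  refine isCurvewiseWeakUpperGradient_of_lipschitzOnWith
    (g := fun x => ‖riemannianGradient (n := n) f x‖₊) ?_
    (lipschitzOnWith_of_nnnorm_riemannianGradient_lt hf)
  intro x c hc
  exact upperSemicontinuous_norm_riemannianGradient hf x c hc

end Minimality

end

theorem proposition4 {n : ℕ} {M : Type*} [EMetricSpace M] [SecondCountableTopology M]
    [MeasurableSpace M] [BorelSpace M]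
    [ChartedSpace (EuclideanSpace ℝ (Fin n)) M] [IsManifold (𝓡 n) ∞ M]
    [RiemannianBundle (fun x : M => TangentSpace (𝓡 n) x)]
    [IsContinuousRiemannianBundle (EuclideanSpace ℝ (Fin n)) (fun x : M => TangentSpace (𝓡 n) x)]
    [IsRiemannianManifold (𝓡 n) M]
    (h : M → ℝ) (h_continuous : Continuous h) (h_pos : ∀ x, 0 < h x)
    (f : M → ℝ) (hf : ContMDiff (𝓡 n) 𝓘(ℝ, ℝ) 1 f) :
    -- curvewise form: `|∇f|_g` is the minimal weak upper gradient of every `C¹` function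
    (IsMinimalCurvewiseWeakUpperGradient (weightedRiemannianVolume n h) f
        (fun x => ‖riemannianGradient (n := n) f x‖ₑ) ∧
      ∀ G : M → ℝ≥0∞,
        IsMinimalCurvewiseWeakUpperGradient (weightedRiemannianVolume n h) f G →
        ∀ᵐ x ∂(weightedRiemannianVolume n h), G x = ‖riemannianGradient (n := n) f x‖ₑ) ∧
    -- integrated form: the same for every `C¹` function that has a weak upper gradient at all
    ((∃ G : M → ℝ≥0∞, IsWeakUpperGradient (weightedRiemannianVolume n h) f G) →
      IsMinimalWeakUpperGradient (weightedRiemannianVolume n h) f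
        (fun x => ‖riemannianGradient (n := n) f x‖ₑ)) ∧
    (∀ G : M → ℝ≥0∞,
      IsMinimalWeakUpperGradient (weightedRiemannianVolume n h) f G →
      ∀ᵐ x ∂(weightedRiemannianVolume n h), G x = ‖riemannianGradient (n := n) f x‖ₑ) ∧
    -- and such functions include those with `|∇f|_g ∈ L²(μ)`
    (∫⁻ x, ‖riemannianGradient (n := n) f x‖ₑ ^ 2 ∂(weightedRiemannianVolume n h) < ⊤ →
      ∃ G : M → ℝ≥0∞, IsWeakUpperGradient (weightedRiemannianVolume n h) f G) := by
  have hfm : Measurable f := hf.continuous.measurable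
  have hcurve := isCurvewiseWeakUpperGradient_riemannianGradient
    (weightedRiemannianVolume n h) hf
  have hlower : ∀ G, IsCurvewiseWeakUpperGradient (weightedRiemannianVolume n h) f G →
      (fun x => ‖riemannianGradient (n := n) f x‖ₑ) ≤ᵐ[weightedRiemannianVolume n h] G :=
    fun G hG => hG.enorm_riemannianGradient_le h_continuous h_pos hf
  have hmin : (∃ G : M → ℝ≥0∞, IsWeakUpperGradient (weightedRiemannianVolume n h) f G) →
      IsMinimalWeakUpperGradient (weightedRiemannianVolume n h) f
        (fun x => ‖riemannianGradient (n := n) f x‖ₑ) := by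
    rintro ⟨G, hG⟩
    have hle := hlower G (hG.isCurvewiseWeakUpperGradient hfm)
    exact ⟨hcurve.isWeakUpperGradient fun P hP =>
        (hP.lintegral_mul_metricSpeed_mono hle).trans_lt (hG.lintegral_lt_top P hP),
      fun G' hG' => hlower G' (hG'.isCurvewiseWeakUpperGradient hfm)⟩
  refine ⟨⟨⟨hcurve, hlower⟩, fun G hG => ?_⟩, hmin, fun G hG => ?_, fun hfin => ?_⟩
  · exact (hG.2 _ hcurve).antisymm (hlower G hG.1)
  · have hgrad := hmin ⟨G, hG.1⟩
    exact (hG.2 _ hgrad.1).antisymm (hgrad.2 G hG.1)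
  · exact ⟨_, hcurve.isWeakUpperGradient fun P hP =>
      hP.lintegral_mul_metricSpeed_lt_top (measurable_enorm_riemannianGradient hf) hfin⟩
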